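/- Let $m=(m_k)_{k\ge 0}$ be a bounded sequence of integers $m_k\ge 2$, let $G_m=\prod_{k\ge 0}\mathbb Z/m_k\mathbb Z$ be the corresponding (bounded) Vilenkin group with the product topology, and let $\mu$ be its normalized Haar measure. Put $M_0=1$, $M_{k+1}=m_kM_k$. For $n=\sum_j n_jM_j$ with $0\le n_j<m_j$ let $\psi_n(x)=\prod_k \exp(2\pi i\,n_kx_k/m_k)$ be the Vilenkin functions, and for $f\in L_1(G_m)$ let $\widehat f(k)=\int_{G_m} f\,\overline{\psi_k}\,d\mu$ and $S_nf=\sum_{k=0}^{n-1}\widehat f(k)\psi_k$. Let $(q_k)_{k\ge 0}$ be non-negative numbers with $q_0>0$, let $Q_n=\sum_{k=0}^{n-1}q_k$, and let $$t_nf=\frac1{Q_n}\sum_{k=1}^{n}q_{n-k}S_kf\qquad(n\ge 1)$$ be the Nörlund means. Assume that one of the following holds: (a) $(q_k)$ is non-decreasing and the Nörlund means are regular, that is, $q_{n-1}/Q_n\to 0$ as $n\to\infty$; (b) $(q_k)$ is non-increasing and $1/Q_n=O(1/n)$ as $n\to\infty$. Let $1\le p<\infty$. Then: 1. $\|t_nf-f\|_p\to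 0$ as $n\to\infty$ for every $f\in L_p(G_m)$. 2. If $f\in L_1(G_m)$ is continuous at a point $x$, then $t_nf(x)\to f(x)$. 3. If $f\in L_p(G_m)$ and $x$ is a Vilenkin–Lebesgue point of $f$, then $t_nf(x)\to f(x)$. Here, with $I_A(y)=\{z\in G_m: z_j=y_j \text{ for } j<A\}$ and $e_s\in G_m$ the element whose $s$-th coordinate is $1$ and whose other coordinates are $0$, a point $x$ is a Vilenkin–Lebesgue point of $f\in L_1(G_m)$ if $$\lim_{A\to\infty}\ \sum_{s=0}^{A-1}M_s\sum_{r=1}^{m_s-1}\int_{I_A(x-re_s)}|f(t)-f(x)|\,d\mu(t)=0.$$ -/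

import Mathlib

open MeasureTheory Filter Topology Asymptotics

noncomputable section

namespace Vilenkin

/-- The Vilenkin group of the sequence `m`: the complete direct product of the groups
`ℤ / m k`. It carries the product group structure, the product of the discrete topologies and
the product σ-algebra. -/
abbrev G (m : ℕ → ℕ) : Type := (k : ℕ) → ZMod (m k)

/-- The product of the uniform probability measures on the factors, that is, the normalized
Haar measure. -/
def haar (m : ℕ → ℕ) [∀ k, NeZero (m k)] : Measure (G m) :=
  Measure.infinitePi fun k => (ProbabilityTheory.uniformOn Set.univ : Measure (ZMod (m k)))

instance instIsProbabilityMeasureHaar (m : ℕ → ℕ) [∀ k, NeZero (m k)] :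
    IsProbabilityMeasure (haar m) := by
  unfold haar
  infer_instance

/-- The generalized powers: `M 0 = 1` and `M (k + 1) = m k * M k`. -/
def M (m : ℕ → ℕ) : ℕ → ℕ
  | 0 => 1
  | k + 1 => m k * M m k

/-- The `k`-th digit of `n` in the number system based on `m`. -/
def digit (m : ℕ → ℕ) (n k : ℕ) : ℕ := n / M m k % m k

theorem lt_M (m : ℕ → ℕ) (hm : ∀ k, 2 ≤ m k) (k : ℕ) : k < M m k := by
  induction k with
  | zero => simp [M]
  | succ k ih =>
    have h := Nat.mul_le_mul (hm k) (Nat.succ_le_of_lt ih)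
    simp only [M]
    omega

/-- All digits of `n` from the `n`-th on vanish. -/
theorem digit_eq_zero (m : ℕ → ℕ) (hm : ∀ k, 2 ≤ m k) {n k : ℕ} (h : n ≤ k) :
    digit m n k = 0 := by
  simp [digit, Nat.div_eq_of_lt (h.trans_lt (lt_M m hm k))]

/-- The generalized Rademacher function `r k x = exp (2 π i x_k / m_k)`, where `x_k` is
represented in `{0, …, m_k - 1}`. -/
def rademacher (m : ℕ → ℕ) (k : ℕ) (x : G m) : ℂ :=
  Complex.exp (2 * Real.pi * Complex.I * ((x k).val : ℂ) / (m k : ℂ))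

/-- The Vilenkin function `ψ n`: the product over all `k` of the powers of `rademacher m k` by the
digits of `n`. The factors with `n ≤ k` are equal to one by `digit_eq_zero`. -/
def psi (m : ℕ → ℕ) (n : ℕ) (x : G m) : ℂ :=
  ∏ k ∈ Finset.range n, rademacher m k x ^ digit m n k

/-- The Vilenkin–Fourier coefficients. -/
def fourierCoeff (m : ℕ → ℕ) [∀ k, NeZero (m k)] (f : G m → ℂ) (n : ℕ) : ℂ :=
  ∫ t, f t * (starRingEnd ℂ) (psi m n t) ∂(haar m)

/-- The partial sums of the Vilenkin–Fourier series. -/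
def partialSum (m : ℕ → ℕ) [∀ k, NeZero (m k)] (n : ℕ) (f : G m → ℂ) (x : G m) : ℂ :=
  ∑ k ∈ Finset.range n, fourierCoeff m f k * psi m k x

/-- `Q n = q 0 + ⋯ + q (n - 1)`. -/
def Q (q : ℕ → ℝ) (n : ℕ) : ℝ := ∑ k ∈ Finset.range n, q k

/-- The Nörlund means of the Vilenkin–Fourier series of `f`. -/
def norlundMean (m : ℕ → ℕ) [∀ k, NeZero (m k)] (q : ℕ → ℝ) (n : ℕ) (f : G m → ℂ) (x : G m) : ℂ :=
  (1 / (Q q n : ℂ)) * ∑ k ∈ Finset.Icc 1 n, (q (n - k) : ℂ) * partialSum m k f x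

/-- The neighbourhood of `x` made of all `y` that agree with `x` in the first `n` coordinates. -/
def I (m : ℕ → ℕ) (n : ℕ) (x : G m) : Set (G m) := {y | ∀ j < n, y j = x j}

/-- The operator `W A`. Here `Pi.single s r` is `r • e_s`, with `e_s` the `s`-th unit vector. -/
def W (m : ℕ → ℕ) [∀ k, NeZero (m k)] (A : ℕ) (f : G m → ℂ) (x : G m) : ℝ :=
  ∑ s ∈ Finset.range A, (M m s : ℝ) * ∑ r ∈ Finset.Icc 1 (m s - 1),
    ∫ t in I m A (x - Pi.single s (r : ZMod (m s))), ‖f t - f x‖ ∂(haar m)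

/-- `x` is a Vilenkin–Lebesgue point of the integrable function `f`. -/
def IsVilenkinLebesguePoint (m : ℕ → ℕ) [∀ k, NeZero (m k)] (f : G m → ℂ) (x : G m) : Prop :=
  Integrable f (haar m) ∧ Tendsto (fun A => W m A f x) atTop (𝓝 0)

/-- The regularity condition for Nörlund means: `q (n - 1) / Q n → 0`. -/
def IsNorlundRegular (q : ℕ → ℝ) : Prop :=
  Tendsto (fun n : ℕ => q (n - 1) / Q q n) atTop (𝓝 0)

end Vilenkin

end

open Vilenkin

/-!
The proof rests on one pointwise bound. Writing the Nörlund means as convolutions with the Nörlund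
kernels, it dominates these kernels by averages of the functions `majorant m j`, that is, of
`P_j = M_j 1_{I_j(0)} + ∑_{s < j} M_s ∑_{0 < r < m_s} 1_{I_j(r e_s)}`.

* Summation by parts turns the Nörlund mean into an average `∑ w_{n,k} σ_k f` of Fejér means, where
  `w_{n,k}` is the increment of `q` at `n - k` times `k / Q_n`. Either hypothesis on `q` makes this
  a regular Toeplitz matrix: `∑_k |w_{n,k}|` is bounded and `w_{n,k} → 0` for fixed `k`
  (`weights_of_monotone`, `weights_of_antitone`). So both cases come down to Fejér means.
* The splitting `D_{a M_j + k} = D_{a M_j} + r_j ^ a D_k` of the Dirichlet kernels bounds `k |K_k|`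
  for the Fejér kernel `K_k` by a constant times `∑_{M_j ≤ k} M_j P_j` (`norm_fejerSum_le`): along
  `k = M_j` it shows that `K_{M_j}` lives on points with at most one non-zero coordinate among the
  first `j`, and a general `k` is reduced to these by removing its leading digit. The boundedness
  of `m` enters here. Both steps together give `exists_norlundKernel_bound`.
* The integral of `|f(t) - f(x)| P_j(x - t)` over `t` is exactly `W_j f(x)` plus the mean of
  `|f - f(x)|` over `I_j(x)`, and the latter tends to zero if `W_j f(x)` does
  (`tendsto_mean_of_tendsto_W`). This gives the convergence at Vilenkin–Lebesgue points, and points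
  of continuity are such points.
* Since `∫ P_j ≤ 2`, Schur's test bounds the Nörlund means on `L_p` uniformly. For continuous `f`
  the convergence in `L_p` follows from the pointwise one by dominated convergence, and continuous
  functions are dense.
-/

noncomputable section

namespace Vilenkin

section Kernels

/-! ### Mixed radix digits and Vilenkin functions -/

theorem M_pos (m : ℕ → ℕ) (hm : ∀ k, 2 ≤ m k) (k : ℕ) : 0 < M m k :=
  (Nat.zero_le k).trans_lt (lt_M m hm k)

theorem M_mul_dvd (m : ℕ → ℕ) {i j : ℕ} (h : i < j) : m i * M m i ∣ M m j := by
  induction j, h using Nat.le_induction with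
  | base => exact dvd_rfl
  | succ j _ ih => exact ih.mul_left _

theorem M_le_M (m : ℕ → ℕ) (hm : ∀ k, 2 ≤ m k) {i j : ℕ} (h : i ≤ j) : M m i ≤ M m j := by
  rcases h.eq_or_lt with rfl | h
  · exact le_rfl
  · exact Nat.le_of_dvd (M_pos m hm j) ((Dvd.intro_left _ rfl).trans (M_mul_dvd m h))

/-- Adding `b * M j` to a number below `M j` changes the `j`-th digit only. -/
theorem digit_mul_M_add (m : ℕ → ℕ) (hm : ∀ k, 2 ≤ m k) {j b k : ℕ} (hb : b < m j)
    (hk : k < M m j) (i : ℕ) :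
    digit m (b * M m j + k) i = digit m k i + if i = j then b else 0 := by
  have hpos := M_pos m hm
  rcases lt_trichotomy i j with h | rfl | h
  · obtain ⟨c, hc⟩ := M_mul_dvd m h
    have e : b * M m j + k = k + M m i * (m i * (b * c)) := by rw [hc]; ring
    simp [digit, h.ne, e, Nat.add_mul_div_left _ _ (hpos i)]
  · have e : b * M m i + k = k + M m i * b := by ring
    simp [digit, e, Nat.add_mul_div_left _ _ (hpos i), Nat.div_eq_of_lt hk, Nat.mod_eq_of_lt hb]
  · have h2 : b * M m j + k < M m i :=
      calc b * M m j + k < (b + 1) * M m j := by rw [add_mul]; omega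
        _ ≤ M m (j + 1) := Nat.mul_le_mul_right _ hb
        _ ≤ M m i := M_le_M m hm h
    simp [digit, h.ne', Nat.div_eq_of_lt h2,
      Nat.div_eq_of_lt (hk.trans_le (M_le_M m hm h.le))]

theorem exists_digit_ne_zero (m : ℕ → ℕ) (hm : ∀ k, 2 ≤ m k) {n : ℕ} (hn : n ≠ 0) : ∃ j, digit m n j ≠ 0 := by
  have hex : ∃ j, n < M m j := ⟨n, lt_M m hm n⟩
  obtain ⟨j, hj⟩ : ∃ j, Nat.find hex = j + 1 := Nat.exists_eq_succ_of_ne_zero fun h => by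
    have := Nat.find_spec hex
    rw [h, M] at this
    omega
  have h1 : n < m j * M m j := by
    have := Nat.find_spec hex
    rwa [hj] at this
  have h2 : M m j ≤ n := not_lt.1 (Nat.find_min hex (by omega))
  refine ⟨j, ?_⟩
  rw [digit, Nat.mod_eq_of_lt ((Nat.div_lt_iff_lt_mul (M_pos m hm j)).2 h1)]
  exact (Nat.div_pos h2 (M_pos m hm j)).ne'

theorem psi_eq_prod (m : ℕ → ℕ) (hm : ∀ k, 2 ≤ m k) {n N : ℕ} (h : n ≤ N) (x : G m) :
    psi m n x = ∏ k ∈ Finset.range N, rademacher m k x ^ digit m n k := by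
  refine Finset.prod_subset (Finset.range_mono h) fun k _ hk => ?_
  rw [digit_eq_zero m hm (by simpa using hk), pow_zero]

theorem psi_mul_M_add (m : ℕ → ℕ) (hm : ∀ k, 2 ≤ m k) {j b k : ℕ} (hb : b < m j)
    (hk : k < M m j) (x : G m) :
    psi m (b * M m j + k) x = rademacher m j x ^ b * psi m k x := by
  have h1 : k ≤ b * M m j + k + (j + 1) := by omega
  have h2 : j ∈ Finset.range (b * M m j + k + (j + 1)) := by simp; omega
  rw [psi_eq_prod m hm (Nat.le_add_right _ (j + 1)), psi_eq_prod m hm h1,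
    mul_comm (_ ^ b)]
  simp_rw [digit_mul_M_add m hm hb hk, pow_add]
  rw [Finset.prod_mul_distrib]
  congr 1
  rw [Finset.prod_eq_single_of_mem j h2 (by simp +contextual)]
  simp

/-! ### Dirichlet and Fejér kernels -/

/-- The Dirichlet kernel `D n = ψ 0 + ⋯ + ψ (n - 1)`. -/
def dirichlet (m : ℕ → ℕ) (n : ℕ) (y : G m) : ℂ := ∑ k ∈ Finset.range n, psi m k y

/-- The sum `D 1 + ⋯ + D n`, that is, `n` times the `n`-th Fejér kernel. The index set contains
`0`, which contributes nothing. -/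
def fejerSum (m : ℕ → ℕ) (n : ℕ) (y : G m) : ℂ := ∑ k ∈ Finset.range (n + 1), dirichlet m k y

theorem dirichlet_mul_M_add (m : ℕ → ℕ) (hm : ∀ k, 2 ≤ m k) {j a k : ℕ} (ha : a < m j)
    (hk : k ≤ M m j) (y : G m) :
    dirichlet m (a * M m j + k) y
      = dirichlet m (a * M m j) y + rademacher m j y ^ a * dirichlet m k y := by
  simp only [dirichlet, Finset.sum_range_add, Finset.mul_sum]
  congr 1
  refine Finset.sum_congr rfl fun i hi => psi_mul_M_add m hm ha ?_ y
  have := Finset.mem_range.1 hi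
  omega

theorem dirichlet_mul_M (m : ℕ → ℕ) (hm : ∀ k, 2 ≤ m k) {j a : ℕ} (ha : a ≤ m j) (y : G m) :
    dirichlet m (a * M m j) y
      = dirichlet m (M m j) y * ∑ b ∈ Finset.range a, rademacher m j y ^ b := by
  induction a with
  | zero => simp [dirichlet]
  | succ a ih =>
    rw [add_one_mul, dirichlet_mul_M_add m hm ha le_rfl, ih (Nat.le_of_succ_le ha),
      Finset.sum_range_succ]
    ring

theorem fejerSum_mul_M_add (m : ℕ → ℕ) (hm : ∀ k, 2 ≤ m k) {j a k : ℕ} (ha : a < m j)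
    (hk : k ≤ M m j) (y : G m) :
    fejerSum m (a * M m j + k) y = fejerSum m (a * M m j) y + k * dirichlet m (a * M m j) y
      + rademacher m j y ^ a * fejerSum m k y := by
  have h1 : ∀ i ∈ Finset.range k, dirichlet m (a * M m j + 1 + i) y
      = dirichlet m (a * M m j) y + rademacher m j y ^ a * dirichlet m (i + 1) y := fun i hi => by
    have := Finset.mem_range.1 hi
    rw [add_assoc, add_comm 1 i]
    exact dirichlet_mul_M_add m hm ha (by omega) y
  have h0 : dirichlet m 0 y = 0 := by simp [dirichlet]
  rw [fejerSum, show a * M m j + k + 1 = a * M m j + 1 + k by ring, Finset.sum_range_add,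
    Finset.sum_congr rfl h1, Finset.sum_add_distrib, ← Finset.mul_sum, fejerSum, fejerSum,
    Finset.sum_range_succ' _ k, h0]
  simp
  ring

theorem fejerSum_mul_M (m : ℕ → ℕ) (hm : ∀ k, 2 ≤ m k) {j a : ℕ} (ha : a ≤ m j) (y : G m) :
    fejerSum m (a * M m j) y = M m j * ∑ b ∈ Finset.range a, dirichlet m (b * M m j) y
      + (∑ b ∈ Finset.range a, rademacher m j y ^ b) * fejerSum m (M m j) y := by
  induction a with
  | zero => simp [fejerSum, dirichlet]
  | succ a ih =>
    rw [add_one_mul, fejerSum_mul_M_add m hm ha le_rfl, ih (Nat.le_of_succ_le ha),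
      Finset.sum_range_succ, Finset.sum_range_succ]
    ring

/-! ### Vilenkin functions as characters -/

theorem mem_I_zero {m : ℕ → ℕ} {n : ℕ} {y : G m} : y ∈ I m n 0 ↔ ∀ j < n, y j = 0 := Iff.rfl

variable {m : ℕ → ℕ} [∀ k, NeZero (m k)]

theorem rademacher_eq (k : ℕ) (x : G m) : rademacher m k x = ZMod.stdAddChar (x k) := by
  rw [ZMod.stdAddChar_apply, ZMod.toCircle_apply, rademacher]

theorem norm_rademacher (k : ℕ) (x : G m) : ‖rademacher m k x‖ = 1 := by
  rw [rademacher_eq, ZMod.stdAddChar_apply, Circle.norm_coe]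

theorem rademacher_sub (k : ℕ) (x t : G m) :
    rademacher m k (x - t) = rademacher m k x * (starRingEnd ℂ) (rademacher m k t) := by
  simp only [rademacher_eq, ZMod.stdAddChar_apply, Pi.sub_apply]
  simp only [sub_eq_add_neg,
    AddChar.map_add_eq_mul, AddChar.map_neg_eq_inv, Circle.coe_mul, Circle.coe_inv_eq_conj]

theorem norm_psi (n : ℕ) (x : G m) : ‖psi m n x‖ = 1 := by
  simp [psi, norm_prod, norm_rademacher]

theorem psi_sub (n : ℕ) (x t : G m) :
    psi m n (x - t) = psi m n x * (starRingEnd ℂ) (psi m n t) := by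
  simp [psi, rademacher_sub, mul_pow, Finset.prod_mul_distrib]

theorem rademacher_pow_card (k : ℕ) (x : G m) : rademacher m k x ^ m k = 1 := by
  rw [rademacher_eq, ← AddChar.map_nsmul_eq_pow]
  simp

theorem rademacher_eq_one_iff (k : ℕ) (x : G m) : rademacher m k x = 1 ↔ x k = 0 := by
  rw [rademacher_eq, ← (ZMod.stdAddChar (N := m k)).map_zero_eq_one,
    ZMod.injective_stdAddChar.eq_iff]

theorem sum_rademacher_pow (k : ℕ) (x : G m) :
    ∑ b ∈ Finset.range (m k), rademacher m k x ^ b = if x k = 0 then (m k : ℂ) else 0 := by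
  split_ifs with h
  · simp [(rademacher_eq_one_iff k x).2 h]
  · rw [geom_sum_eq (fun h' => h ((rademacher_eq_one_iff k x).1 h')), rademacher_pow_card]
    simp

theorem norm_sum_rademacher_pow_le (k a : ℕ) (x : G m) :
    ‖∑ b ∈ Finset.range a, rademacher m k x ^ b‖ ≤ a := by
  refine (norm_sum_le _ _).trans ?_
  simp [norm_rademacher]

theorem mem_I_zero_succ {m : ℕ → ℕ} {n : ℕ} {y : G m} : y ∈ I m (n + 1) 0 ↔ y ∈ I m n 0 ∧ y n = 0 := by
  simp only [mem_I_zero]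
  refine ⟨fun h => ⟨fun j hj => h j (by omega), h n (by omega)⟩, fun h j hj => ?_⟩
  rcases (Nat.lt_succ_iff.1 hj).eq_or_lt with rfl | h'
  exacts [h.2, h.1 j h']

/-! ### Bounds for the Fejér kernels -/

theorem dirichlet_M (hm : ∀ k, 2 ≤ m k) (j : ℕ) (y : G m) :
    dirichlet m (M m j) y = (I m j 0).indicator (fun _ => (M m j : ℂ)) y := by
  induction j with
  | zero => simp [dirichlet, M, psi, Set.indicator, mem_I_zero]
  | succ j ih =>
    rw [M, dirichlet_mul_M m hm le_rfl, ih, sum_rademacher_pow]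
    by_cases h1 : y ∈ I m j 0 <;> by_cases h2 : y j = 0 <;>
      simp [mem_I_zero_succ, h1, h2, mul_comm]

theorem norm_dirichlet_mul_M_le (hm : ∀ k, 2 ≤ m k) {j a : ℕ} (ha : a ≤ m j) (y : G m) :
    ‖dirichlet m (a * M m j) y‖ ≤ a * (I m j 0).indicator (fun _ => (M m j : ℝ)) y := by
  rw [dirichlet_mul_M m hm ha, norm_mul, dirichlet_M hm, mul_comm, norm_indicator_eq_indicator_norm]
  simp only [Complex.norm_natCast]
  gcongr
  · exact Set.indicator_nonneg (fun _ _ => Nat.cast_nonneg _) _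
  · exact norm_sum_rademacher_pow_le _ _ _

theorem norm_fejerSum_mul_M_le (hm : ∀ k, 2 ≤ m k) {j a : ℕ} (ha : a ≤ m j) (y : G m) :
    ‖fejerSum m (a * M m j) y‖
      ≤ a ^ 2 * (M m j * (I m j 0).indicator (fun _ => (M m j : ℝ)) y)
        + ‖∑ b ∈ Finset.range a, rademacher m j y ^ b‖ * ‖fejerSum m (M m j) y‖ := by
  rw [fejerSum_mul_M m hm ha]
  refine (norm_add_le _ _).trans ?_
  rw [norm_mul, norm_mul, Complex.norm_natCast]
  refine add_le_add_left ?_ _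
  have hb : ∀ b ∈ Finset.range a, ‖dirichlet m (b * M m j) y‖
      ≤ a * (I m j 0).indicator (fun _ => (M m j : ℝ)) y := fun b hb => by
    have hb := (Finset.mem_range.1 hb).le
    refine (norm_dirichlet_mul_M_le hm (hb.trans ha) y).trans ?_
    gcongr
    exact Set.indicator_nonneg (fun _ _ => Nat.cast_nonneg _) _
  calc (M m j : ℝ) * ‖∑ b ∈ Finset.range a, dirichlet m (b * M m j) y‖
      ≤ M m j * (a • (a * (I m j 0).indicator (fun _ => (M m j : ℝ)) y)) := by
        gcongr
        exact (norm_sum_le_of_le _ hb).trans (by simp)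
    _ = _ := by rw [nsmul_eq_mul]; ring

/-- Along the subsequence `M A`, the Fejér kernel is supported on the points with at most one
non-zero coordinate among the first `A`, and if this is the `s`-th coordinate, then its values are
of order `M s`. -/
theorem norm_fejerSum_M_le (hm : ∀ k, 2 ≤ m k) {B : ℕ} (hB : ∀ k, m k ≤ B) (A : ℕ) (y : G m) :
    ‖fejerSum m (M m A) y‖ ≤ M m A * ((I m A 0).indicator 1 y
      + B * ∑ s ∈ Finset.range A,
        M m s * Set.indicator {z : G m | ∀ i < A, i ≠ s → z i = 0} (1 : G m → ℝ) y) := by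
  induction A with
  | zero => simp [fejerSum, dirichlet, M, psi, Set.indicator, mem_I_zero, Finset.sum_range_succ]
  | succ A ih =>
    have h1 := norm_fejerSum_mul_M_le hm (le_refl (m A)) y
    rw [sum_rademacher_pow] at h1
    have hs : {z : G m | ∀ i < A + 1, i ≠ A → z i = 0} = I m A 0 := by
      ext z
      refine ⟨fun h i hi => h i (by omega) hi.ne, fun h i _ _ => h i (by omega)⟩
    have hE : ∀ s ∈ Finset.range A,
        Set.indicator {z : G m | ∀ i < A + 1, i ≠ s → z i = 0} (1 : G m → ℝ) y
        = if y A = 0 then Set.indicator {z : G m | ∀ i < A, i ≠ s → z i = 0} (1 : G m → ℝ) y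
          else 0 := fun s hs => by
      have hs := Finset.mem_range.1 hs
      have : y ∈ {z : G m | ∀ i < A + 1, i ≠ s → z i = 0}
          ↔ y A = 0 ∧ y ∈ {z : G m | ∀ i < A, i ≠ s → z i = 0} := by
        refine ⟨fun h => ⟨h A (by omega) (by omega), fun i hi => h i (by omega)⟩,
          fun h i hi hi' => ?_⟩
        rcases (Nat.lt_succ_iff.1 hi).eq_or_lt with rfl | h'
        exacts [h.1, h.2 i h' hi']
      by_cases h2 : y A = 0 <;> by_cases h3 : y ∈ {z : G m | ∀ i < A, i ≠ s → z i = 0}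
      · rw [if_pos h2, Set.indicator_of_mem h3, Set.indicator_of_mem (this.2 ⟨h2, h3⟩)]
      · rw [if_pos h2, Set.indicator_of_notMem h3, Set.indicator_of_notMem]
        exact fun h => h3 (this.1 h).2
      · rw [if_neg h2, Set.indicator_of_notMem]
        exact fun h => h2 (this.1 h).1
      · rw [if_neg h2, Set.indicator_of_notMem]
        exact fun h => h2 (this.1 h).1
    rw [Finset.sum_range_succ, hs, Finset.sum_congr rfl fun s hs => by rw [hE s hs]]
    have hmB : (m A : ℝ) ≤ B := by exact_mod_cast hB A
    have hind : (I m A 0).indicator (fun _ => (M m A : ℝ)) y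
        = M m A * (I m A 0).indicator (1 : G m → ℝ) y := by
      by_cases h : y ∈ I m A 0 <;> simp [h]
    have hi0 : 0 ≤ (I m A 0).indicator (1 : G m → ℝ) y :=
      Set.indicator_nonneg (fun _ _ => zero_le_one) _
    rw [hind] at h1
    have h5 : (m A : ℝ) ^ 2 * (M m A * (M m A * (I m A 0).indicator (1 : G m → ℝ) y))
        ≤ (m A * M m A) * (B * (M m A * (I m A 0).indicator (1 : G m → ℝ) y)) := by
      rw [show (m A : ℝ) ^ 2 * (M m A * (M m A * (I m A 0).indicator (1 : G m → ℝ) y))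
        = (m A * M m A) * (m A * (M m A * (I m A 0).indicator (1 : G m → ℝ) y)) by ring]
      gcongr
    rw [M]
    push_cast
    by_cases h : y A = 0
    · simp only [h, if_true, Complex.norm_natCast] at h1 ⊢
      have h3 : (I m (A + 1) 0).indicator (1 : G m → ℝ) y = (I m A 0).indicator 1 y := by
        by_cases h' : y ∈ I m A 0 <;> simp [mem_I_zero_succ, h', h]
      rw [h3]
      have h4 := mul_le_mul_of_nonneg_left ih (Nat.cast_nonneg (α := ℝ) (m A))
      linarith
    · simp only [h, if_false, norm_zero, zero_mul, add_zero, mul_zero, Finset.sum_const_zero,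
        zero_add] at h1 ⊢
      have h3 : (I m (A + 1) 0).indicator (1 : G m → ℝ) y = 0 := by
        simp [mem_I_zero_succ, h]
      rw [h3]
      linarith

end Kernels

section Majorant

/-! ### The majorant of the Fejér kernels -/

variable {m : ℕ → ℕ}

/-- The majorant of the Fejér kernels along the subsequence `M j`. Its convolution with
`|f - f x|` at `x` is `W m j f x`, plus the mean of `|f - f x|` over `I m j x`. -/
def majorant (m : ℕ → ℕ) (j : ℕ) (y : G m) : ℝ :=
  M m j * (I m j 0).indicator 1 y + ∑ s ∈ Finset.range j, (M m s : ℝ) *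
    ∑ r ∈ Finset.Icc 1 (m s - 1), (I m j (Pi.single s (r : ZMod (m s)))).indicator 1 y

theorem indicator_one_nonneg (s : Set (G m)) (y : G m) : 0 ≤ s.indicator (1 : G m → ℝ) y :=
  Set.indicator_nonneg (fun _ _ => zero_le_one) _

theorem M_mul_indicator_le_majorant (j : ℕ) (y : G m) :
    M m j * (I m j 0).indicator (1 : G m → ℝ) y ≤ majorant m j y :=
  le_add_of_nonneg_right <| Finset.sum_nonneg fun _ _ => mul_nonneg (Nat.cast_nonneg _) <|
    Finset.sum_nonneg fun _ _ => indicator_one_nonneg _ _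

theorem majorant_nonneg (j : ℕ) (y : G m) : 0 ≤ majorant m j y :=
  (mul_nonneg (Nat.cast_nonneg _) (indicator_one_nonneg _ _)).trans
    (M_mul_indicator_le_majorant j y)

theorem sum_M_le (hm : ∀ k, 2 ≤ m k) (A : ℕ) : ∑ s ∈ Finset.range A, (M m s : ℝ) ≤ M m A := by
  induction A with
  | zero => simp
  | succ A ih =>
    rw [Finset.sum_range_succ, M]
    have : (2 : ℝ) ≤ m A := by exact_mod_cast hm A
    push_cast
    nlinarith [Nat.cast_nonneg (α := ℝ) (M m A)]

variable [∀ k, NeZero (m k)]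

/-- A point with at most one non-zero coordinate among the first `A`, the `s`-th, agrees in these
coordinates with `0` or with some `r e_s`. -/
theorem indicator_one_nonzero_coord_le (A s : ℕ) (hs : s < A) (y : G m) :
    Set.indicator {z : G m | ∀ i < A, i ≠ s → z i = 0} (1 : G m → ℝ) y
      ≤ (I m A 0).indicator 1 y + ∑ r ∈ Finset.Icc 1 (m s - 1),
        (I m A (Pi.single s (r : ZMod (m s)))).indicator 1 y := by
  have hsum : 0 ≤ ∑ r ∈ Finset.Icc 1 (m s - 1),
        (I m A (Pi.single s (r : ZMod (m s)))).indicator (1 : G m → ℝ) y :=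
    Finset.sum_nonneg fun _ _ => indicator_one_nonneg _ _
  by_cases h : y ∈ {z : G m | ∀ i < A, i ≠ s → z i = 0}
  · rw [Set.indicator_of_mem h, Pi.one_apply]
    by_cases h0 : y s = 0
    · have : y ∈ I m A 0 := fun i hi => by
        by_cases his : i = s
        · subst his; exact h0
        · exact h i hi his
      rw [Set.indicator_of_mem this, Pi.one_apply]
      linarith
    · have hv : (y s).val ∈ Finset.Icc 1 (m s - 1) := by
        have h1 := ZMod.val_lt (y s)
        have h2 : (y s).val ≠ 0 := by simpa using h0
        simp only [Finset.mem_Icc]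
        omega
      have hy : y ∈ I m A (Pi.single s (((y s).val : ℕ) : ZMod (m s))) := fun i hi => by
        by_cases his : i = s
        · subst his; simp
        · simp [his, h i hi his]
      have := Finset.single_le_sum (f := fun r : ℕ =>
        (I m A (Pi.single s (r : ZMod (m s)))).indicator (1 : G m → ℝ) y)
        (fun _ _ => indicator_one_nonneg _ _) hv
      simp only [Set.indicator_of_mem hy, Pi.one_apply] at this
      linarith [indicator_one_nonneg (I m A 0) y]
  · rw [Set.indicator_of_notMem h]
    exact add_nonneg (indicator_one_nonneg _ _) hsum

theorem norm_fejerSum_M_le_majorant (hm : ∀ k, 2 ≤ m k) {B : ℕ} (hB : ∀ k, m k ≤ B) (A : ℕ)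
    (y : G m) : ‖fejerSum m (M m A) y‖ ≤ M m A * ((1 + B) * majorant m A y) := by
  refine (norm_fejerSum_M_le hm hB A y).trans ?_
  have h0 := indicator_one_nonneg (I m A 0) y
  have h1 : ∑ s ∈ Finset.range A,
        M m s * Set.indicator {z : G m | ∀ i < A, i ≠ s → z i = 0} (1 : G m → ℝ) y
      ≤ majorant m A y := by
    calc _ ≤ ∑ s ∈ Finset.range A, (M m s : ℝ) * ((I m A 0).indicator 1 y +
            ∑ r ∈ Finset.Icc 1 (m s - 1),
              (I m A (Pi.single s (r : ZMod (m s)))).indicator 1 y) := by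
          gcongr with s hs
          exact indicator_one_nonzero_coord_le A s (Finset.mem_range.1 hs) y
      _ ≤ _ := by
          simp_rw [mul_add, Finset.sum_add_distrib]
          rw [← Finset.sum_mul, majorant]
          gcongr
          exact sum_M_le hm A
  have h2 : (I m A 0).indicator (1 : G m → ℝ) y ≤ majorant m A y := by
    refine le_trans ?_ (M_mul_indicator_le_majorant A y)
    refine le_mul_of_one_le_left h0 ?_
    exact_mod_cast M_pos m hm A
  rw [add_mul, one_mul]
  gcongr

/-- The pointwise bound of an arbitrary Fejér kernel by those along the subsequence `M j`. -/
theorem norm_fejerSum_le (hm : ∀ k, 2 ≤ m k) {B : ℕ} (hB : ∀ k, m k ≤ B) (n : ℕ) (y : G m) :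
    ‖fejerSum m n y‖ ≤ (B ^ 2 + B * (1 + B) + B) *
      ∑ j ∈ Finset.range n with M m j ≤ n, (M m j : ℝ) * majorant m j y := by
  have hterm : ∀ j : ℕ, 0 ≤ (M m j : ℝ) * majorant m j y := fun j =>
    mul_nonneg (Nat.cast_nonneg _) (majorant_nonneg j y)
  suffices key : ∀ j, ∀ n < M m j, ‖fejerSum m n y‖ ≤ (B ^ 2 + B * (1 + B) + B) *
      ∑ j ∈ Finset.range j with M m j ≤ n, (M m j : ℝ) * majorant m j y from
    key n n (lt_M m hm n)
  intro j
  induction j with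
  | zero =>
    intro n hn
    obtain rfl : n = 0 := by simpa [M] using hn
    simp [fejerSum, dirichlet]
  | succ j ih =>
    intro n hn
    have hMj := M_pos m hm j
    rcases lt_or_ge n (M m j) with hlt | hge
    · refine (ih n hlt).trans ?_
      gcongr
      · exact fun _ _ _ => hterm _
      · omega
    · -- Remove the leading digit `n / M j`; the remainder is below `M j`.
      have ha : n / M m j < m j := by rw [Nat.div_lt_iff_lt_mul hMj]; exact hn
      have hk : n % M m j < M m j := Nat.mod_lt _ hMj
      have hn' : n = n / M m j * M m j + n % M m j := by
        rw [mul_comm]; exact (Nat.div_add_mod _ _).symm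
      have haB : ((n / M m j : ℕ) : ℝ) ≤ B := by exact_mod_cast ha.le.trans (hB j)
      have hind : (I m j 0).indicator (fun _ => (M m j : ℝ)) y ≤ majorant m j y := by
        refine le_trans (le_of_eq ?_) (M_mul_indicator_le_majorant j y)
        by_cases h : y ∈ I m j 0 <;> simp [h]
      have h1 : ‖fejerSum m (n / M m j * M m j) y‖
          ≤ B ^ 2 * (M m j * majorant m j y) + B * (M m j * ((1 + B) * majorant m j y)) := by
        refine (norm_fejerSum_mul_M_le hm ha.le y).trans ?_
        gcongr
        · exact mul_nonneg (Nat.cast_nonneg _)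
            (Set.indicator_nonneg (fun _ _ => Nat.cast_nonneg _) _)
        · exact (norm_sum_rademacher_pow_le _ _ _).trans haB
        · exact norm_fejerSum_M_le_majorant hm hB j y
      have h2 : ‖((n % M m j : ℕ) : ℂ) * dirichlet m (n / M m j * M m j) y‖
          ≤ M m j * (B * majorant m j y) := by
        rw [norm_mul, Complex.norm_natCast]
        have := (norm_dirichlet_mul_M_le hm ha.le y).trans
          (mul_le_mul haB hind (Set.indicator_nonneg (fun _ _ => Nat.cast_nonneg _) _)
            (Nat.cast_nonneg _))
        gcongr
      have h3 := ih _ hk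
      have hsub : ∑ i ∈ Finset.range j with M m i ≤ n % M m j, (M m i : ℝ) * majorant m i y
          ≤ ∑ i ∈ Finset.range j with M m i ≤ n, (M m i : ℝ) * majorant m i y := by
        refine Finset.sum_le_sum_of_subset_of_nonneg ?_ fun _ _ _ => hterm _
        intro i
        simp only [Finset.mem_filter]
        have := Nat.mod_le n (M m j)
        exact fun h => ⟨h.1, h.2.trans this⟩
      rw [Finset.range_add_one, Finset.filter_insert, if_pos hge, Finset.sum_insert (by simp)]
      have e : fejerSum m n y = fejerSum m (n / M m j * M m j) y
          + ((n % M m j : ℕ) : ℂ) * dirichlet m (n / M m j * M m j) y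
          + rademacher m j y ^ (n / M m j) * fejerSum m (n % M m j) y := by
        rw [← fejerSum_mul_M_add m hm ha hk.le, ← hn']
      rw [e]
      refine (norm_add₃_le).trans ?_
      rw [norm_mul (_ ^ _), norm_pow, norm_rademacher, one_pow, one_mul, mul_add]
      have h4 := h3.trans (mul_le_mul_of_nonneg_left hsub (by positivity))
      linarith

end Majorant

section Norlund

/-! ### Toeplitz summation and the weights of Nörlund means -/

/-- The Silverman–Toeplitz theorem for null sequences, with finite rows. -/
theorem tendsto_toeplitz {w : ℕ → ℕ → ℝ} {v : ℕ → ℝ} {C : ℝ} (hw : ∀ n k, 0 ≤ w n k)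
    (hC : ∀ᶠ n in atTop, ∑ k ∈ Finset.range (n + 1), w n k ≤ C)
    (hw0 : ∀ k, Tendsto (fun n => w n k) atTop (𝓝 0)) (hv : ∀ k, 0 ≤ v k)
    (hv0 : Tendsto v atTop (𝓝 0)) :
    Tendsto (fun n => ∑ k ∈ Finset.range (n + 1), w n k * v k) atTop (𝓝 0) := by
  have hC0 : 0 ≤ C := by
    obtain ⟨n, hn⟩ := hC.exists
    exact (Finset.sum_nonneg fun k _ => hw n k).trans hn
  refine tendsto_order.2 ⟨fun a ha => Eventually.of_forall fun n => ha.trans_le <|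
    Finset.sum_nonneg fun k _ => mul_nonneg (hw n k) (hv k), fun ε hε => ?_⟩
  set δ := ε / (2 * (C + 1)) with hδ
  have hδ0 : 0 < δ := by positivity
  obtain ⟨N, hN⟩ := eventually_atTop.1 (hv0.eventually (gt_mem_nhds hδ0))
  have hfin : Tendsto (fun n => ∑ k ∈ Finset.range N, w n k * v k) atTop (𝓝 0) := by
    simpa using tendsto_finsetSum (Finset.range N) fun k _ => (hw0 k).mul_const (v k)
  filter_upwards [hC, hfin.eventually (gt_mem_nhds (half_pos hε))] with n h1 h2
  have h3 : ∑ k ∈ Finset.range (n + 1), w n k * v k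
      ≤ ∑ k ∈ Finset.range N, w n k * v k + ∑ k ∈ Finset.range (n + 1), w n k * δ := by
    calc _ ≤ ∑ k ∈ Finset.range (n + 1), ((if k < N then w n k * v k else 0) + w n k * δ) := by
          refine Finset.sum_le_sum fun k _ => ?_
          split_ifs with hk
          · exact le_add_of_nonneg_right (mul_nonneg (hw n k) hδ0.le)
          · rw [zero_add]
            exact mul_le_mul_of_nonneg_left (hN k (not_lt.1 hk)).le (hw n k)
      _ ≤ _ := by
          rw [Finset.sum_add_distrib, ← Finset.sum_filter]
          gcongr
          · exact fun k _ _ => mul_nonneg (hw n k) (hv k)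
          · intro k
            simp
  rw [← Finset.sum_mul] at h3
  have h4 : (∑ k ∈ Finset.range (n + 1), w n k) * δ ≤ C * δ := by gcongr
  have h5 : C * δ < ε / 2 := by
    have : (C + 1) * δ = ε / 2 := by rw [hδ]; field_simp
    linarith
  linarith

/-- The sequence of differences of `q`, starting with `q 0`. -/
def increment {R : Type*} [Ring R] (q : ℕ → R) : ℕ → R
  | 0 => q 0
  | k + 1 => q (k + 1) - q k

/-- Summation by parts. -/
theorem sum_mul_eq_sum_increment_mul {R : Type*} [CommRing R] (q D : ℕ → R) (n : ℕ) :
    ∑ k ∈ Finset.range (n + 1), q (n - k) * D k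
      = ∑ k ∈ Finset.range (n + 1), increment q (n - k) * ∑ l ∈ Finset.range (k + 1), D l := by
  induction n with
  | zero => simp [increment]
  | succ n ih =>
    have h1 : ∑ k ∈ Finset.range (n + 1 + 1), increment q (n + 1 - k) *
          ∑ l ∈ Finset.range (k + 1), D l
        = ∑ k ∈ Finset.range (n + 1 + 1), increment q (n + 1 - k) * D k
          + ∑ k ∈ Finset.range (n + 1), increment q (n - k) *
              ∑ l ∈ Finset.range (k + 1), D l := by
      have e : ∀ k ∈ Finset.range (n + 1 + 1),
          increment q (n + 1 - k) * ∑ l ∈ Finset.range (k + 1), D l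
            = increment q (n + 1 - k) * D k
              + increment q (n + 1 - k) * ∑ l ∈ Finset.range k, D l := fun k _ => by
        rw [Finset.sum_range_succ, mul_add, add_comm]
      rw [Finset.sum_congr rfl e, Finset.sum_add_distrib]
      congr 1
      rw [Finset.sum_range_succ']
      simp
    have h2 : ∀ k ∈ Finset.range (n + 1),
        q (n + 1 - k) * D k = increment q (n + 1 - k) * D k + q (n - k) * D k := fun k hk => by
      have := Finset.mem_range.1 hk
      rw [show n + 1 - k = n - k + 1 by omega, increment]
      ring
    have h3 : increment q (n + 1 - (n + 1)) = q (n + 1 - (n + 1)) := by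
      rw [Nat.sub_self, increment]
    rw [h1, ← ih, Finset.sum_range_succ, Finset.sum_congr rfl h2, Finset.sum_add_distrib,
      Finset.sum_range_succ (fun k => increment q (n + 1 - k) * D k) (n + 1), h3]
    ring

theorem sum_increment_mul_eq_Q (q : ℕ → ℝ) (n : ℕ) :
    ∑ k ∈ Finset.range (n + 1), increment q (n - k) * k = Q q n := by
  have h := sum_mul_eq_sum_increment_mul q (fun k => if k = 0 then 0 else 1) n
  simp only [Finset.sum_range_succ' (fun k => if k = 0 then (0 : ℝ) else 1)] at h
  rw [Finset.sum_range_succ'] at h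
  simp only [Nat.add_eq_zero_iff, one_ne_zero, and_false, if_false, if_true, mul_one, mul_zero,
    add_zero, Finset.sum_const, Finset.card_range, nsmul_eq_mul] at h
  rw [← h, Q, ← Finset.sum_range_reflect q]
  refine Finset.sum_congr rfl fun k _ => ?_
  rw [Nat.sub_sub, add_comm 1 k]

theorem sum_Icc_sub_eq_Q (q : ℕ → ℝ) (n : ℕ) : ∑ k ∈ Finset.Icc 1 n, q (n - k) = Q q n := by
  refine Finset.sum_nbij' (fun k => n - k) (fun k => n - k) ?_ ?_ ?_ ?_ fun _ _ => rfl <;>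
    simp only [Finset.mem_Icc, Finset.mem_range] <;> omega

/-- The absolute value of the weight of the `k`-th Fejér mean in the `n`-th Nörlund mean. -/
def weight (q : ℕ → ℝ) (n k : ℕ) : ℝ := |increment q (n - k)| * k / Q q n

theorem Q_nonneg {q : ℕ → ℝ} (hq : ∀ k, 0 ≤ q k) (n : ℕ) : 0 ≤ Q q n :=
  Finset.sum_nonneg fun k _ => hq k

theorem Q_pos {q : ℕ → ℝ} (hq : ∀ k, 0 ≤ q k) (hq0 : 0 < q 0) {n : ℕ} (hn : n ≠ 0) :
    0 < Q q n :=
  hq0.trans_le <| Finset.single_le_sum (fun k _ => hq k)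
    (Finset.mem_range.2 (Nat.pos_of_ne_zero hn))

theorem weight_nonneg {q : ℕ → ℝ} (hq : ∀ k, 0 ≤ q k) (n k : ℕ) : 0 ≤ weight q n k :=
  div_nonneg (mul_nonneg (abs_nonneg _) (Nat.cast_nonneg _)) (Q_nonneg hq n)

theorem weights_of_monotone {q : ℕ → ℝ} (hq : ∀ k, 0 ≤ q k) (hmono : Monotone q)
    (hreg : IsNorlundRegular q) :
    (∀ n, ∑ k ∈ Finset.range (n + 1), weight q n k ≤ 1) ∧
      ∀ k, Tendsto (fun n => weight q n k) atTop (𝓝 0) := by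
  have hinc : ∀ i, 0 ≤ increment q i ∧ increment q i ≤ q i := by
    rintro (_ | i)
    · exact ⟨hq 0, le_rfl⟩
    · exact ⟨sub_nonneg.2 (hmono (Nat.le_succ i)), sub_le_self _ (hq i)⟩
  refine ⟨fun n => ?_, fun k => ?_⟩
  · simp only [weight]
    simp_rw [abs_of_nonneg (hinc _).1]
    rw [← Finset.sum_div, sum_increment_mul_eq_Q]
    exact div_self_le_one _
  · have h := hreg.const_mul (k : ℝ)
    rw [mul_zero] at h
    refine squeeze_zero (fun n => weight_nonneg hq n k) (fun n => ?_) h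
    rw [weight, abs_of_nonneg (hinc _).1, mul_comm, mul_div_assoc]
    rcases Nat.eq_zero_or_pos k with rfl | hk
    · simp
    · refine mul_le_mul_of_nonneg_left (div_le_div_of_nonneg_right ?_ (Q_nonneg hq n))
        (Nat.cast_nonneg _)
      exact (hinc _).2.trans (hmono (by omega))

theorem weights_of_antitone {q : ℕ → ℝ} (hq : ∀ k, 0 ≤ q k) (hq0 : 0 < q 0)
    (hanti : Antitone q) (hO : (fun n : ℕ => 1 / Q q n) =O[atTop] (fun n : ℕ => 1 / (n : ℝ))) :
    (∃ C, ∀ᶠ n in atTop, ∑ k ∈ Finset.range (n + 1), weight q n k ≤ C) ∧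
      ∀ k, Tendsto (fun n => weight q n k) atTop (𝓝 0) := by
  -- The increment at `0` is `q 0` and all others are non-positive, so the absolute weights sum to
  -- `(2 q_0 n - Q_n) / Q_n`.
  have habs : ∀ i, |increment q i| = -increment q i + if i = 0 then 2 * q 0 else 0 := by
    rintro (_ | i)
    · rw [increment, abs_of_nonneg (hq 0), if_pos rfl]
      ring
    · rw [increment, abs_of_nonpos (sub_nonpos.2 (hanti (Nat.le_succ i))), if_neg (by omega),
        add_zero]
  have hle : ∀ i, |increment q i| ≤ q 0 := by
    rintro (_ | i)
    · rw [increment, abs_of_nonneg (hq 0)]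
    · rw [increment, abs_of_nonpos (sub_nonpos.2 (hanti (Nat.le_succ i)))]
      linarith [hq (i + 1), hanti (Nat.zero_le i)]
  refine ⟨?_, fun k => ?_⟩
  · obtain ⟨C, hC⟩ := hO.bound
    refine ⟨2 * q 0 * C, ?_⟩
    filter_upwards [hC, eventually_ne_atTop 0] with n hn hn0
    have hQ := Q_pos hq hq0 hn0
    have hn1 : (0 : ℝ) < n := by exact_mod_cast Nat.pos_of_ne_zero hn0
    rw [Real.norm_of_nonneg (by positivity), Real.norm_of_nonneg (by positivity),
      mul_one_div, div_le_div_iff₀ hQ hn1, one_mul] at hn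
    have hsum : ∑ k ∈ Finset.range (n + 1), |increment q (n - k)| * k
        = -Q q n + 2 * q 0 * n := by
      simp_rw [habs, add_mul]
      rw [Finset.sum_add_distrib, ← sum_increment_mul_eq_Q q n, ← Finset.sum_neg_distrib]
      congr 1
      · simp only [neg_mul]
      · rw [Finset.sum_eq_single_of_mem n (by simp)]
        · simp
        · intro k hk hkn
          have := Finset.mem_range.1 hk
          rw [if_neg (by omega), zero_mul]
    simp only [weight]
    rw [← Finset.sum_div, hsum, div_le_iff₀ hQ]
    nlinarith
  · have h1 : Tendsto (fun n : ℕ => 1 / Q q n) atTop (𝓝 0) :=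
      hO.trans_tendsto tendsto_one_div_atTop_nhds_zero_nat
    have h := h1.const_mul (q 0 * k)
    rw [mul_zero] at h
    refine squeeze_zero (fun n => weight_nonneg hq n k) (fun n => ?_) h
    rw [weight, mul_one_div]
    exact div_le_div_of_nonneg_right
      (mul_le_mul_of_nonneg_right (hle _) (Nat.cast_nonneg _)) (Q_nonneg hq n)

/-! ### Nörlund kernels -/

variable {m : ℕ → ℕ}

/-- The kernel of the Nörlund means. -/
def norlundKernel (m : ℕ → ℕ) (q : ℕ → ℝ) (n : ℕ) (y : G m) : ℂ :=
  (1 / (Q q n : ℂ)) * ∑ k ∈ Finset.Icc 1 n, (q (n - k) : ℂ) * dirichlet m k y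

theorem norm_norlundKernel_le_sum (q : ℕ → ℝ) (hq : ∀ k, 0 ≤ q k) (n : ℕ) (y : G m) :
    ‖norlundKernel m q n y‖
      ≤ ∑ k ∈ Finset.range (n + 1), |increment q (n - k)| / Q q n * ‖fejerSum m k y‖ := by
  have h1 : ∑ k ∈ Finset.Icc 1 n, (q (n - k) : ℂ) * dirichlet m k y
      = ∑ k ∈ Finset.range (n + 1), ((increment q (n - k) : ℝ) : ℂ) * fejerSum m k y := by
    have h := sum_mul_eq_sum_increment_mul (fun k => (q k : ℂ)) (fun k => dirichlet m k y) n
    have hinc : ∀ i, increment (fun k => (q k : ℂ)) i = ((increment q i : ℝ) : ℂ) := by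
      rintro (_ | i) <;> simp [increment]
    simp only [hinc] at h
    simp only [fejerSum]
    rw [← h]
    refine Finset.sum_subset (fun k => by simp) fun k hk hk' => ?_
    have h0 : k = 0 := by simp at hk hk'; omega
    simp [h0, dirichlet]
  have hQ := Q_nonneg hq n
  rw [norlundKernel, h1, Finset.mul_sum]
  refine norm_sum_le_of_le _ fun k _ => le_of_eq ?_
  rw [norm_mul, norm_mul, norm_div, norm_one, Complex.norm_real, Complex.norm_real,
    Real.norm_of_nonneg hQ, Real.norm_eq_abs]
  ring

variable [∀ k, NeZero (m k)]

/-- The Nörlund kernels are dominated by averages of the majorants, and the weights of these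
averages form a regular Toeplitz matrix. -/
theorem exists_norlundKernel_bound (hm : ∀ k, 2 ≤ m k) (hbdd : BddAbove (Set.range m))
    {q : ℕ → ℝ} (hq : ∀ k, 0 ≤ q k) (hq0 : 0 < q 0)
    (hmono : (Monotone q ∧ IsNorlundRegular q) ∨
      (Antitone q ∧ (fun n : ℕ => 1 / Q q n) =O[atTop] (fun n : ℕ => 1 / (n : ℝ)))) :
    ∃ (c : ℕ → ℕ → ℝ) (C : ℝ), (∀ n j, 0 ≤ c n j) ∧
      (∀ᶠ n in atTop, ∑ j ∈ Finset.range (n + 1), c n j ≤ C) ∧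
      (∀ j, Tendsto (fun n => c n j) atTop (𝓝 0)) ∧
      ∀ n (y : G m), ‖norlundKernel m q n y‖
        ≤ ∑ j ∈ Finset.range (n + 1), c n j * majorant m j y := by
  obtain ⟨B, hB⟩ := hbdd
  replace hB : ∀ k, m k ≤ B := fun k => hB ⟨k, rfl⟩
  obtain ⟨⟨C, hC⟩, hw0⟩ : (∃ C, ∀ᶠ n in atTop, ∑ k ∈ Finset.range (n + 1), weight q n k ≤ C) ∧
      ∀ k, Tendsto (fun n => weight q n k) atTop (𝓝 0) := by
    rcases hmono with ⟨h1, h2⟩ | ⟨h1, h2⟩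
    · obtain ⟨h3, h4⟩ := weights_of_monotone hq h1 h2
      exact ⟨⟨1, Eventually.of_forall h3⟩, h4⟩
    · exact weights_of_antitone hq hq0 h1 h2
  set K : ℝ := B ^ 2 + B * (1 + B) + B with hK
  have hK0 : 0 ≤ K := by positivity
  -- `u j k` is the weight of the `j`-th majorant in the bound of the `k`-th Fejér kernel.
  set u : ℕ → ℕ → ℝ := fun j k => if M m j ≤ k then K * M m j / k else 0 with hu
  have hu0 : ∀ j k, 0 ≤ u j k := fun j k => by
    simp only [hu]
    split_ifs <;> positivity
  have hw := weight_nonneg hq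
  refine ⟨fun n j => ∑ k ∈ Finset.range (n + 1), weight q n k * u j k, C * (2 * K),
    fun n j => Finset.sum_nonneg fun k _ => mul_nonneg (hw n k) (hu0 j k), ?_, fun j => ?_,
    fun n y => ?_⟩
  · filter_upwards [hC] with n hn
    rw [Finset.sum_comm]
    simp_rw [← Finset.mul_sum]
    calc _ ≤ ∑ k ∈ Finset.range (n + 1), weight q n k * (2 * K) := by
          refine Finset.sum_le_sum fun k _ => mul_le_mul_of_nonneg_left ?_ (hw n k)
          simp only [hu]
          rw [← Finset.sum_filter]
          rcases Nat.eq_zero_or_pos k with rfl | hk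
          · simp [hK0]
          have hk' : (0 : ℝ) < k := by exact_mod_cast hk
          -- The indices `j` with `M j ≤ k` form an initial segment of `ℕ`.
          set J := Nat.findGreatest (fun j => M m j ≤ k) k with hJ
          have hJk : M m J ≤ k :=
            Nat.findGreatest_spec (P := fun j => M m j ≤ k) (Nat.zero_le k) hk
          have hsub : ({j ∈ Finset.range (n + 1) | M m j ≤ k} : Finset ℕ)
              ⊆ Finset.range (J + 1) := fun j hj => by
            have hj := (Finset.mem_filter.1 hj).2
            exact Finset.mem_range.2 (Nat.lt_succ_iff.2
              (Nat.le_findGreatest ((lt_M m hm j).le.trans hj) hj))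
          calc _ ≤ ∑ j ∈ Finset.range (J + 1), K * M m j / k :=
                Finset.sum_le_sum_of_subset_of_nonneg hsub fun _ _ _ => by positivity
            _ = K * (∑ j ∈ Finset.range (J + 1), (M m j : ℝ)) / k := by
                rw [Finset.mul_sum, Finset.sum_div]
            _ ≤ K * (2 * k) / k := by
                gcongr
                rw [Finset.sum_range_succ]
                have h1 := sum_M_le hm J
                have h2 : (M m J : ℝ) ≤ k := by exact_mod_cast hJk
                linarith
            _ = 2 * K := by field_simp
      _ ≤ C * (2 * K) := by
          rw [← Finset.sum_mul]
          gcongr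
  · refine tendsto_toeplitz hw hC hw0 (hu0 j) ?_
    refine squeeze_zero (hu0 j) (fun k => ?_) (tendsto_const_div_atTop_nhds_zero_nat (K * M m j))
    simp only [hu]
    split_ifs
    · exact le_rfl
    · positivity
  · refine (norm_norlundKernel_le_sum q hq n y).trans ?_
    simp_rw [Finset.sum_mul]
    rw [Finset.sum_comm]
    refine Finset.sum_le_sum fun k hk => ?_
    have hkn := Finset.mem_range.1 hk
    calc _ ≤ |increment q (n - k)| / Q q n * (K *
            ∑ j ∈ Finset.range k with M m j ≤ k, (M m j : ℝ) * majorant m j y) := by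
          have := Q_nonneg hq n
          gcongr
          exact norm_fejerSum_le hm hB k y
      _ = ∑ j ∈ Finset.range k with M m j ≤ k, weight q n k * u j k * majorant m j y := by
          rw [Finset.mul_sum, Finset.mul_sum]
          refine Finset.sum_congr rfl fun j hj => ?_
          obtain ⟨hj1, hj2⟩ := Finset.mem_filter.1 hj
          have hk0 : (k : ℝ) ≠ 0 := by
            have := Finset.mem_range.1 hj1
            exact_mod_cast (by omega : k ≠ 0)
          simp only [hu, if_pos hj2, weight]
          field_simp
      _ ≤ _ := by
          refine Finset.sum_le_sum_of_subset_of_nonneg (fun j hj => ?_) fun j _ _ =>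
            mul_nonneg (mul_nonneg (hw n k) (hu0 j k)) (majorant_nonneg j y)
          have := Finset.mem_range.1 (Finset.mem_filter.1 hj).1
          exact Finset.mem_range.2 (by omega)

end Norlund

section Haar

/-! ### The Haar measure -/

variable {m : ℕ → ℕ}

theorem I_eq_pi (n : ℕ) (x : G m) :
    I m n x = Set.pi (Finset.range n : Set ℕ) fun j => {x j} := by
  ext y
  simp [I]

theorem measurableSet_I (n : ℕ) (x : G m) : MeasurableSet (I m n x) := by
  rw [I_eq_pi]
  exact MeasurableSet.pi (Finset.countable_toSet _) fun _ _ => measurableSet_singleton _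

theorem sub_mem_I_iff (n : ℕ) (x t a : G m) : x - t ∈ I m n a ↔ t ∈ I m n (x - a) := by
  refine forall₂_congr fun j _ => ?_
  rw [Pi.sub_apply, Pi.sub_apply, sub_eq_iff_eq_add, eq_sub_iff_add_eq, add_comm, eq_comm]

theorem sub_mem_I_iff' (n : ℕ) (x t a : G m) : x - t ∈ I m n a ↔ x ∈ I m n (t + a) := by
  refine forall₂_congr fun j _ => ?_
  rw [Pi.sub_apply, Pi.add_apply, sub_eq_iff_eq_add, add_comm]

variable [∀ k, NeZero (m k)]

theorem haar_I (n : ℕ) (x : G m) : haar m (I m n x) = (M m n : ENNReal)⁻¹ := by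
  rw [I_eq_pi, haar, Measure.infinitePi_pi _ (fun _ _ => measurableSet_singleton _)]
  induction n with
  | zero => simp [M]
  | succ n ih =>
    rw [Finset.prod_range_succ, ih, M, ProbabilityTheory.uniformOn_univ]
    simp only [Measure.count_singleton, ZMod.card, one_div]
    push_cast
    rw [← ENNReal.mul_inv (by simp) (by simp), mul_comm]

theorem haar_real_I (n : ℕ) (x : G m) : (haar m).real (I m n x) = (M m n : ℝ)⁻¹ := by
  simp [Measure.real, haar_I]

theorem measurePreserving_add_right (a : G m) :
    MeasurePreserving (fun x => x + a) (haar m) (haar m) := by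
  refine ⟨by fun_prop, ?_⟩
  have h : ∀ k, (ProbabilityTheory.uniformOn Set.univ : Measure (ZMod (m k))).map (· + a k)
      = ProbabilityTheory.uniformOn Set.univ := fun k => by
    refine Measure.ext fun s hs => ?_
    have e : (· + a k) ⁻¹' s = (Equiv.addRight (a k)).symm '' s :=
      ((Equiv.addRight (a k)).image_symm_eq_preimage s).symm
    rw [Measure.map_apply (measurable_of_countable _) hs, ProbabilityTheory.uniformOn_univ,
      ProbabilityTheory.uniformOn_univ, e, Measure.count_apply (Set.toFinite _).measurableSet,
      Measure.count_apply hs, (Equiv.addRight (a k)).symm.injective.encard_image]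
  have := Measure.infinitePi_map_pi
    (μ := fun k => (ProbabilityTheory.uniformOn Set.univ : Measure (ZMod (m k))))
    (f := fun k y => y + a k) fun k => measurable_of_countable _
  simp_rw [h] at this
  exact this

/-! ### Orthogonality and convolution formulas -/

theorem measurable_psi (n : ℕ) : Measurable (psi m n) := by
  refine Finset.measurable_prod _ fun k _ => Measurable.pow_const ?_ _
  exact (measurable_of_countable fun z : ZMod (m k) =>
    Complex.exp (2 * Real.pi * Complex.I * (z.val : ℂ) / (m k : ℂ))).comp (measurable_pi_apply k)

theorem exists_psi_ne_one (hm : ∀ k, 2 ≤ m k) {n : ℕ} (hn : n ≠ 0) : ∃ a : G m, psi m n a ≠ 1 := by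
  obtain ⟨j, hj⟩ := exists_digit_ne_zero m hm hn
  refine ⟨Pi.single j 1, ?_⟩
  have hjn : j ∈ Finset.range n := by
    by_contra h
    exact hj (digit_eq_zero m hm (by simpa using h))
  rw [psi, Finset.prod_eq_single_of_mem j hjn fun i _ hi => by
    rw [(rademacher_eq_one_iff i _).2 (Pi.single_eq_of_ne hi _), one_pow], rademacher_eq,
    Pi.single_eq_same, ← AddChar.map_nsmul_eq_pow, ← (ZMod.stdAddChar (N := m j)).map_zero_eq_one,
    ZMod.injective_stdAddChar.ne_iff, nsmul_one, Ne, ZMod.natCast_eq_zero_iff]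
  exact fun h => hj (Nat.eq_zero_of_dvd_of_lt h (Nat.mod_lt _ (by linarith [hm j])))

theorem psi_add (n : ℕ) (x t : G m) : psi m n (x + t) = psi m n x * psi m n t := by
  simp only [psi, rademacher_eq, Pi.add_apply, AddChar.map_add_eq_mul, mul_pow,
    Finset.prod_mul_distrib]

theorem integral_psi (hm : ∀ k, 2 ≤ m k) {n : ℕ} (hn : n ≠ 0) : ∫ t, psi m n t ∂(haar m) = 0 := by
  -- Translating by `a` multiplies the integral by `psi m n a ≠ 1`.
  obtain ⟨a, ha⟩ := exists_psi_ne_one hm hn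
  have h1 : ∫ t, psi m n (t + a) ∂(haar m) = ∫ t, psi m n t ∂(haar m) := by
    have hmp := measurePreserving_add_right a
    rw [← integral_map hmp.aemeasurable (measurable_psi n).aestronglyMeasurable, hmp.map_eq]
  simp_rw [psi_add] at h1
  rw [integral_mul_const] at h1
  have h2 : (∫ t, psi m n t ∂(haar m)) * (psi m n a - 1) = 0 := by linear_combination h1
  exact (mul_eq_zero.1 h2).resolve_right (sub_ne_zero.2 ha)

theorem integrable_mul_conj_psi {f : G m → ℂ} (hf : Integrable f (haar m)) (n : ℕ) :
    Integrable (fun t => f t * (starRingEnd ℂ) (psi m n t)) (haar m) := by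
  refine hf.mul_bdd (c := 1) ?_ (ae_of_all _ fun t => by simp [norm_psi])
  exact (Complex.continuous_conj.measurable.comp (measurable_psi n)).aestronglyMeasurable

theorem partialSum_const (hm : ∀ k, 2 ≤ m k) {n : ℕ} (hn : n ≠ 0) (c : ℂ) (x : G m) :
    partialSum m n (fun _ => c) x = c := by
  have h : ∀ k ≠ 0, fourierCoeff m (fun _ => c) k = 0 := fun k hk => by
    rw [fourierCoeff, integral_const_mul, integral_conj, integral_psi hm hk]
    simp
  rw [partialSum, Finset.sum_eq_single_of_mem 0 (by simpa using Nat.pos_of_ne_zero hn)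
    fun k _ hk => by rw [h k hk, zero_mul]]
  simp [fourierCoeff, psi]

theorem norlundMean_const (hm : ∀ k, 2 ≤ m k) {q : ℕ → ℝ} (hq : ∀ k, 0 ≤ q k) (hq0 : 0 < q 0)
    {n : ℕ} (hn : n ≠ 0) (c : ℂ) (x : G m) : norlundMean m q n (fun _ => c) x = c := by
  have h1 : ∑ k ∈ Finset.Icc 1 n, (q (n - k) : ℂ) * partialSum m k (fun _ => c) x
      = (Q q n : ℂ) * c := by
    rw [Finset.sum_congr rfl fun k hk => by
      rw [partialSum_const hm (Nat.pos_iff_ne_zero.1 (Finset.mem_Icc.1 hk).1)], ← Finset.sum_mul,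
      ← sum_Icc_sub_eq_Q, Complex.ofReal_sum]
  have h2 : (Q q n : ℂ) ≠ 0 := by exact_mod_cast (Q_pos hq hq0 hn).ne'
  rw [norlundMean, h1, ← mul_assoc, one_div, inv_mul_cancel₀ h2, one_mul]

theorem fourierCoeff_sub {f g : G m → ℂ} (hf : Integrable f (haar m)) (hg : Integrable g (haar m))
    (n : ℕ) : fourierCoeff m (fun t => f t - g t) n = fourierCoeff m f n - fourierCoeff m g n := by
  simp only [fourierCoeff, sub_mul]
  exact integral_sub (integrable_mul_conj_psi hf n) (integrable_mul_conj_psi hg n)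

theorem norlundMean_sub {f g : G m → ℂ} (hf : Integrable f (haar m)) (hg : Integrable g (haar m))
    (q : ℕ → ℝ) (n : ℕ) (x : G m) :
    norlundMean m q n (fun t => f t - g t) x = norlundMean m q n f x - norlundMean m q n g x := by
  simp only [norlundMean, partialSum, fourierCoeff_sub hf hg, sub_mul, mul_sub,
    Finset.sum_sub_distrib]

theorem partialSum_eq_integral {f : G m → ℂ} (hf : Integrable f (haar m)) (n : ℕ) (x : G m) :
    partialSum m n f x = ∫ t, f t * dirichlet m n (x - t) ∂(haar m) := by
  simp only [dirichlet, psi_sub, Finset.mul_sum, partialSum, fourierCoeff]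
  rw [integral_finsetSum]
  · refine Finset.sum_congr rfl fun k _ => ?_
    rw [← integral_mul_const]
    congr 1 with t
    ring
  · intro k _
    refine ((integrable_mul_conj_psi hf k).mul_const (psi m k x)).congr (ae_of_all _ fun t => ?_)
    simp only
    ring

theorem measurable_dirichlet (n : ℕ) : Measurable (dirichlet m n) :=
  Finset.measurable_sum _ fun k _ => measurable_psi k

theorem integrable_mul_dirichlet {f : G m → ℂ} (hf : Integrable f (haar m)) (n : ℕ) (x : G m) :
    Integrable (fun t => f t * dirichlet m n (x - t)) (haar m) := by
  refine hf.mul_bdd (c := n) ?_ (ae_of_all _ fun t => ?_)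
  · exact ((measurable_dirichlet n).comp (by fun_prop)).aestronglyMeasurable
  · exact (norm_sum_le _ _).trans (by simp [norm_psi])

theorem norlundMean_eq_integral {f : G m → ℂ} (hf : Integrable f (haar m)) (q : ℕ → ℝ) (n : ℕ)
    (x : G m) :
    norlundMean m q n f x = ∫ t, f t * norlundKernel m q n (x - t) ∂(haar m) := by
  have h : ∀ t, f t * norlundKernel m q n (x - t) = (1 / (Q q n : ℂ)) *
      ∑ k ∈ Finset.Icc 1 n, (q (n - k) : ℂ) * (f t * dirichlet m k (x - t)) := fun t => by
    rw [norlundKernel, mul_left_comm, Finset.mul_sum]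
    simp_rw [mul_left_comm (f t)]
  simp_rw [h, norlundMean, partialSum_eq_integral hf]
  rw [integral_const_mul,
    integral_finsetSum _ fun k _ => (integrable_mul_dirichlet hf k x).const_mul _]
  simp only [integral_const_mul]

theorem measurable_norlundMean (q : ℕ → ℝ) (n : ℕ) (f : G m → ℂ) :
    Measurable (norlundMean m q n f) := by
  refine Measurable.const_mul (Finset.measurable_sum _ fun k _ => Measurable.const_mul ?_ _) _
  exact Finset.measurable_sum _ fun k _ => (measurable_psi k).const_mul _

end Haar

section Convolution

/-! ### Convolution with the majorants -/

variable {m : ℕ → ℕ}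

/-- The value at `x` of the convolution of `g` with `majorant m j`. -/
def convMajorant (m : ℕ → ℕ) [∀ k, NeZero (m k)] (j : ℕ) (g : G m → ℝ) (x : G m) : ℝ :=
  ∫ t, g t * majorant m j (x - t) ∂(haar m)

theorem majorant_sub (j : ℕ) (x t : G m) :
    majorant m j (x - t) = M m j * (I m j x).indicator 1 t + ∑ s ∈ Finset.range j, (M m s : ℝ) *
      ∑ r ∈ Finset.Icc 1 (m s - 1), (I m j (x - Pi.single s (r : ZMod (m s)))).indicator 1 t := by
  have h : ∀ a : G m, (I m j a).indicator (1 : G m → ℝ) (x - t)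
      = (I m j (x - a)).indicator 1 t := fun a => by
    classical
    simp only [Set.indicator_apply, sub_mem_I_iff, Pi.one_apply]
  simp_rw [majorant, h, sub_zero]

theorem majorant_sub' (j : ℕ) (x t : G m) :
    majorant m j (x - t) = M m j * (I m j t).indicator 1 x + ∑ s ∈ Finset.range j, (M m s : ℝ) *
      ∑ r ∈ Finset.Icc 1 (m s - 1), (I m j (t + Pi.single s (r : ZMod (m s)))).indicator 1 x := by
  have h : ∀ a : G m, (I m j a).indicator (1 : G m → ℝ) (x - t)
      = (I m j (t + a)).indicator 1 x := fun a => by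
    classical
    simp only [Set.indicator_apply, sub_mem_I_iff', Pi.one_apply]
  simp_rw [majorant, h, add_zero]

theorem measurable_majorant (j : ℕ) : Measurable (majorant m j) := by
  have h : ∀ a : G m, Measurable ((I m j a).indicator (1 : G m → ℝ)) := fun a =>
    measurable_one.indicator (measurableSet_I j a)
  refine ((h 0).const_mul _).add (Finset.measurable_sum _ fun s _ => Measurable.const_mul ?_ _)
  exact Finset.measurable_sum _ fun r _ => h _

theorem majorant_le (j : ℕ) : ∃ K, ∀ y : G m, majorant m j y ≤ K := by
  have h : ∀ (a y : G m), (I m j a).indicator (1 : G m → ℝ) y ≤ 1 := fun a y =>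
    Set.indicator_le_self' (fun _ _ => zero_le_one) y
  refine ⟨M m j * 1 + ∑ s ∈ Finset.range j, (M m s : ℝ) * ∑ r ∈ Finset.Icc 1 (m s - 1), 1,
    fun y => ?_⟩
  rw [majorant]
  gcongr <;> exact h _ _

theorem sum_M_mul_eq (hm : ∀ k, 2 ≤ m k) (j : ℕ) :
    ∑ s ∈ Finset.range j, (M m s : ℝ) * ((m s - 1 : ℕ) : ℝ) = M m j - 1 := by
  induction j with
  | zero => simp [M]
  | succ j ih =>
    have : 1 ≤ m j := by linarith [hm j]
    rw [Finset.sum_range_succ, ih, M]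
    push_cast [this]
    ring

theorem exists_I_subset {x : G m} {s : Set (G m)} (hs : s ∈ 𝓝 x) : ∃ N, I m N x ⊆ s := by
  obtain ⟨u, hus, hu, hxu⟩ := mem_nhds_iff.1 hs
  obtain ⟨F, v, hv, hvu⟩ := isOpen_pi_iff.1 hu x hxu
  refine ⟨F.sup id + 1, fun y hy => hus (hvu fun i hi => ?_)⟩
  rw [hy i (Nat.lt_succ_of_le (Finset.le_sup (f := id) hi))]
  exact (hv i hi).2

variable [∀ k, NeZero (m k)]

theorem integrable_mul_majorant {g : G m → ℝ} (hg : Integrable g (haar m)) (j : ℕ) (x : G m) :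
    Integrable (fun t => g t * majorant m j (x - t)) (haar m) := by
  obtain ⟨K, hK⟩ := majorant_le (m := m) j
  refine hg.mul_bdd (c := K) ?_ (ae_of_all _ fun t => ?_)
  · exact ((measurable_majorant j).comp (by fun_prop)).aestronglyMeasurable
  · rw [Real.norm_of_nonneg (majorant_nonneg _ _)]
    exact hK _

theorem convMajorant_eq {g : G m → ℝ} (hg : Integrable g (haar m)) (j : ℕ) (x : G m) :
    convMajorant m j g x = M m j * ∫ t in I m j x, g t ∂(haar m) +
      ∑ s ∈ Finset.range j, (M m s : ℝ) * ∑ r ∈ Finset.Icc 1 (m s - 1),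
        ∫ t in I m j (x - Pi.single s (r : ZMod (m s))), g t ∂(haar m) := by
  have h : ∀ a t : G m, g t * (I m j a).indicator (1 : G m → ℝ) t = (I m j a).indicator g t :=
    fun a t => by by_cases h : t ∈ I m j a <;> simp [h]
  have hi : ∀ a : G m, Integrable ((I m j a).indicator g) (haar m) := fun a =>
    hg.indicator (measurableSet_I j a)
  simp_rw [convMajorant, majorant_sub, mul_add, Finset.mul_sum, mul_left_comm (g _), h]
  rw [integral_add ((hi _).const_mul _)
    (integrable_finsetSum _ fun s _ => integrable_finsetSum _ fun r _ => (hi _).const_mul _),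
    integral_finsetSum _ fun s _ => integrable_finsetSum _ fun r _ => (hi _).const_mul _]
  simp_rw [integral_finsetSum _ fun r _ => (hi _).const_mul _, integral_const_mul,
    integral_indicator (measurableSet_I _ _)]

theorem integral_sum_indicator_I (hm : ∀ k, 2 ≤ m k) (j : ℕ) (z : (s : ℕ) → ℕ → G m) (x : G m) :
    ∫ t, (M m j * (I m j x).indicator (1 : G m → ℝ) t + ∑ s ∈ Finset.range j, (M m s : ℝ) *
      ∑ r ∈ Finset.Icc 1 (m s - 1), (I m j (z s r)).indicator (1 : G m → ℝ) t) ∂(haar m) ≤ 2 := by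
  have hi : ∀ a : G m, Integrable ((I m j a).indicator (1 : G m → ℝ)) (haar m) := fun a =>
    (integrable_const (1 : ℝ)).indicator (measurableSet_I j a)
  have hint : ∀ a : G m, ∫ t, (I m j a).indicator (1 : G m → ℝ) t ∂(haar m) = (M m j : ℝ)⁻¹ :=
    fun a => by rw [integral_indicator_one (measurableSet_I j a), haar_real_I]
  rw [integral_add ((hi _).const_mul _)
    (integrable_finsetSum _ fun s _ => (integrable_finsetSum _ fun r _ => hi _).const_mul _),
    integral_finsetSum _ fun s _ => (integrable_finsetSum _ fun r _ => hi _).const_mul _]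
  simp_rw [integral_const_mul, integral_finsetSum _ fun r _ => hi _, hint]
  simp only [Finset.sum_const, Nat.card_Icc, nsmul_eq_mul, Nat.add_sub_cancel]
  have hM : (0 : ℝ) < M m j := by exact_mod_cast M_pos m hm j
  simp_rw [← mul_assoc]
  rw [← Finset.sum_mul, sum_M_mul_eq hm, ← add_mul]
  rw [mul_inv_le_iff₀ hM]
  linarith

theorem integral_majorant_sub_left_le (hm : ∀ k, 2 ≤ m k) (j : ℕ) (x : G m) :
    ∫ t, majorant m j (x - t) ∂(haar m) ≤ 2 := by
  simp_rw [majorant_sub]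
  exact integral_sum_indicator_I hm j _ x

theorem integral_majorant_sub_right_le (hm : ∀ k, 2 ≤ m k) (j : ℕ) (t : G m) :
    ∫ x, majorant m j (x - t) ∂(haar m) ≤ 2 := by
  simp_rw [majorant_sub']
  exact integral_sum_indicator_I hm j _ t

theorem norm_norlundMean_le {f : G m → ℂ} (hf : Integrable f (haar m)) {q : ℕ → ℝ}
    {c : ℕ → ℕ → ℝ} {n : ℕ}
    (hc : ∀ y : G m, ‖norlundKernel m q n y‖
      ≤ ∑ j ∈ Finset.range (n + 1), c n j * majorant m j y) (x : G m) :
    ‖norlundMean m q n f x‖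
      ≤ ∑ j ∈ Finset.range (n + 1), c n j * convMajorant m j (fun t => ‖f t‖) x := by
  have hint : ∀ j, Integrable (fun t => ‖f t‖ * majorant m j (x - t)) (haar m) := fun j =>
    integrable_mul_majorant hf.norm j x
  rw [norlundMean_eq_integral hf]
  simp_rw [convMajorant, ← integral_const_mul]
  rw [← integral_finsetSum _ fun j _ => (hint j).const_mul _]
  refine norm_integral_le_of_norm_le (integrable_finsetSum _ fun j _ => (hint j).const_mul _)
    (ae_of_all _ fun t => ?_)
  rw [norm_mul]
  simp_rw [mul_left_comm (c _ _), ← Finset.mul_sum]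
  exact mul_le_mul_of_nonneg_left (hc _) (norm_nonneg _)

/-! ### Vilenkin–Lebesgue points -/

theorem tendsto_haar_I (z : ℕ → G m) (hm : ∀ k, 2 ≤ m k) :
    Tendsto (fun A => haar m (I m A (z A))) atTop (𝓝 0) := by
  simp_rw [haar_I]
  refine ENNReal.tendsto_inv_nat_nhds_zero.comp ?_
  exact tendsto_atTop_mono (fun k => (lt_M m hm k).le) tendsto_id

/-- `W A f x → 0` already forces the means over the neighbourhoods `I A x` themselves to tend to
zero, since `I A x` without `I (A + 1) x` is the union of the sets `I (A + 1) (x - r e_A)`. -/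
theorem tendsto_mean_of_tendsto_W (hm : ∀ k, 2 ≤ m k) {g : G m → ℝ} (hg : Integrable g (haar m))
    (hg0 : ∀ t, 0 ≤ g t) (x : G m)
    (hW : Tendsto (fun A => ∑ s ∈ Finset.range A, (M m s : ℝ) * ∑ r ∈ Finset.Icc 1 (m s - 1),
      ∫ t in I m A (x - Pi.single s (r : ZMod (m s))), g t ∂(haar m)) atTop (𝓝 0)) :
    Tendsto (fun A => (M m A : ℝ) * ∫ t in I m A x, g t ∂(haar m)) atTop (𝓝 0) := by
  have hi0 : ∀ A (z : G m), 0 ≤ ∫ t in I m A z, g t ∂(haar m) := fun A z =>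
    integral_nonneg hg0
  have hstep : ∀ A, ∫ t in I m A x, g t ∂(haar m) ≤ ∫ t in I m (A + 1) x, g t ∂(haar m) +
      ∑ r ∈ Finset.Icc 1 (m A - 1),
        ∫ t in I m (A + 1) (x - Pi.single A (r : ZMod (m A))), g t ∂(haar m) := fun A => by
    simp_rw [← integral_indicator (measurableSet_I _ _)]
    have hi : ∀ B (a : G m), Integrable ((I m B a).indicator g) (haar m) := fun B a =>
      hg.indicator (measurableSet_I B a)
    rw [← integral_finsetSum _ fun r _ => hi _ _,
      ← integral_add (hi _ _) (integrable_finsetSum _ fun r _ => hi _ _)]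
    refine integral_mono (hi _ _)
      ((hi _ _).add (integrable_finsetSum _ fun r _ => hi _ _)) fun t => ?_
    have h := indicator_one_nonzero_coord_le (A + 1) A (Nat.lt_succ_self A) (x - t)
    have hs : {z : G m | ∀ i < A + 1, i ≠ A → z i = 0} = I m A 0 := by
      ext z
      exact ⟨fun h i hi => h i (by omega) hi.ne, fun h i _ _ => h i (by omega)⟩
    have e : ∀ B (a : G m), (I m B (x - a)).indicator g t
        = g t * (I m B a).indicator 1 (x - t) := fun B a => by
      classical
      simp [Set.indicator_apply, sub_mem_I_iff]
    rw [hs] at h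
    have e0 := fun B => e B 0
    simp only [sub_zero] at e0
    simp only [e, e0]
    rw [← Finset.mul_sum, ← mul_add]
    exact mul_le_mul_of_nonneg_left h (hg0 t)
  refine tendsto_order.2 ⟨fun a ha => Eventually.of_forall fun A => ha.trans_le <|
    mul_nonneg (Nat.cast_nonneg _) (hi0 _ _), fun ε hε => ?_⟩
  obtain ⟨N, hN⟩ := eventually_atTop.1 (hW.eventually (gt_mem_nhds (half_pos (half_pos hε))))
  filter_upwards [eventually_ge_atTop N] with A hA
  have hMpos : ∀ B, (0 : ℝ) < M m B := fun B => by exact_mod_cast M_pos m hm B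
  -- The sequence `∫_{I B x} g - (ε / 2) / M B` is non-decreasing and tends to zero.
  have hmono : Monotone fun i =>
      ∫ t in I m (A + i) x, g t ∂(haar m) - ε / 2 / M m (A + i) := by
    refine monotone_nat_of_le_succ fun i => ?_
    have h1 := hN (A + i + 1) (by omega)
    rw [Finset.sum_range_succ] at h1
    have h2 : 0 ≤ ∑ s ∈ Finset.range (A + i), (M m s : ℝ) * ∑ r ∈ Finset.Icc 1 (m s - 1),
        ∫ t in I m (A + i + 1) (x - Pi.single s (r : ZMod (m s))), g t ∂(haar m) :=
      Finset.sum_nonneg fun s _ => mul_nonneg (Nat.cast_nonneg _) <|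
        Finset.sum_nonneg fun r _ => hi0 _ _
    have h3 := hstep (A + i)
    have h4 : ∑ r ∈ Finset.Icc 1 (m (A + i) - 1),
        ∫ t in I m (A + i + 1) (x - Pi.single (A + i) (r : ZMod (m (A + i)))), g t ∂(haar m)
        ≤ ε / 2 / 2 / M m (A + i) := by
      rw [le_div_iff₀ (hMpos _), mul_comm]
      linarith
    have h5 : ε / 2 / M m (A + i + 1) ≤ ε / 2 / 2 / M m (A + i) := by
      rw [div_div (ε / 2)]
      have : (2 : ℝ) ≤ m (A + i) := by exact_mod_cast hm _
      have h6 := hMpos (A + i)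
      refine div_le_div_of_nonneg_left (half_pos hε).le (by positivity) ?_
      rw [M]
      push_cast
      gcongr
    have h7 : ε / 2 / M m (A + i) = ε / 2 / 2 / M m (A + i) + ε / 2 / 2 / M m (A + i) := by ring
    rw [← add_assoc]
    linarith
  have hlim : Tendsto (fun i => ∫ t in I m (A + i) x, g t ∂(haar m) - ε / 2 / M m (A + i))
      atTop (𝓝 (0 - 0)) := by
    have hshift : Tendsto (fun i => A + i) atTop atTop :=
      tendsto_atTop_mono (fun i => Nat.le_add_left i A) tendsto_id
    refine Tendsto.sub ?_ ?_
    · exact (hg.tendsto_setIntegral_nhds_zero (tendsto_haar_I (fun _ => x) hm)).comp hshift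
    · refine Tendsto.comp (g := fun i => ε / 2 / (M m i : ℝ)) ?_ hshift
      refine (tendsto_const_div_atTop_nhds_zero_nat (ε / 2)).comp ?_
      exact tendsto_atTop_mono (fun k => (lt_M m hm k).le) tendsto_id
  have h := hmono.ge_of_tendsto hlim 0
  simp only [add_zero, sub_zero, sub_nonpos] at h
  rw [le_div_iff₀ (hMpos _), mul_comm] at h
  linarith

/-- Points of continuity are Vilenkin–Lebesgue points. -/
theorem isVilenkinLebesguePoint_of_continuousAt (hm : ∀ k, 2 ≤ m k) {f : G m → ℂ}
    (hf : Integrable f (haar m)) {x : G m} (hx : ContinuousAt f x) :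
    IsVilenkinLebesguePoint m f x := by
  refine ⟨hf, ?_⟩
  have hg : Integrable (fun t => ‖f t - f x‖) (haar m) := (hf.sub (integrable_const _)).norm
  have hi0 : ∀ A (z : G m), 0 ≤ ∫ t in I m A z, ‖f t - f x‖ ∂(haar m) := fun A z =>
    integral_nonneg fun _ => norm_nonneg _
  refine tendsto_order.2 ⟨fun a ha => Eventually.of_forall fun A => ha.trans_le <|
    Finset.sum_nonneg fun s _ => mul_nonneg (Nat.cast_nonneg _) <|
      Finset.sum_nonneg fun r _ => hi0 _ _, fun ε hε => ?_⟩
  obtain ⟨N, hN⟩ := exists_I_subset (hx (Metric.ball_mem_nhds (f x) (half_pos hε)))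
  have hfin : Tendsto (fun A => ∑ s ∈ Finset.range N, (M m s : ℝ) *
      ∑ r ∈ Finset.Icc 1 (m s - 1),
        ∫ t in I m A (x - Pi.single s (r : ZMod (m s))), ‖f t - f x‖ ∂(haar m)) atTop (𝓝 0) := by
    have h : ∀ z : G m, Tendsto (fun A => ∫ t in I m A z, ‖f t - f x‖ ∂(haar m)) atTop (𝓝 0) :=
      fun z => hg.tendsto_setIntegral_nhds_zero (tendsto_haar_I (fun _ => z) hm)
    have h2 := tendsto_finsetSum (Finset.range N) fun s _ => (tendsto_finsetSum
      (Finset.Icc 1 (m s - 1)) fun r _ => h (x - Pi.single s (r : ZMod (m s)))).const_mul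
        (M m s : ℝ)
    simpa using h2
  filter_upwards [hfin.eventually (gt_mem_nhds (half_pos hε)), eventually_ge_atTop N] with A hA hNA
  have hMpos : (0 : ℝ) < M m A := by exact_mod_cast M_pos m hm A
  have hsmall : ∀ s, N ≤ s → ∀ r ∈ Finset.Icc 1 (m s - 1),
      ∫ t in I m A (x - Pi.single s (r : ZMod (m s))), ‖f t - f x‖ ∂(haar m)
        ≤ ε / 2 * (M m A : ℝ)⁻¹ := fun s hs r _ => by
    have hsub : ∀ t ∈ I m A (x - Pi.single s (r : ZMod (m s))), ‖f t - f x‖ ≤ ε / 2 :=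
      fun t ht => by
        have htN : t ∈ I m N x := fun i hi => by
          rw [ht i (by omega), Pi.sub_apply, Pi.single_eq_of_ne (by omega), sub_zero]
        rw [← dist_eq_norm]
        exact (Metric.mem_ball.1 (hN htN)).le
    calc _ ≤ ∫ t in I m A (x - Pi.single s (r : ZMod (m s))), ε / 2 ∂(haar m) :=
          setIntegral_mono_on hg.integrableOn (integrable_const _).integrableOn
            (measurableSet_I _ _) hsub
      _ = _ := by rw [setIntegral_const, haar_real_I, smul_eq_mul, mul_comm]
  have hsum : W m A f x ≤ ∑ s ∈ Finset.range N, (M m s : ℝ) * ∑ r ∈ Finset.Icc 1 (m s - 1),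
        ∫ t in I m A (x - Pi.single s (r : ZMod (m s))), ‖f t - f x‖ ∂(haar m)
      + ∑ s ∈ Finset.range A, (M m s : ℝ) * ((m s - 1 : ℕ) : ℝ) * (ε / 2 * (M m A : ℝ)⁻¹) := by
    rw [W, Finset.range_eq_Ico, ← Finset.sum_Ico_consecutive _ (Nat.zero_le N) hNA,
      Finset.range_eq_Ico]
    refine add_le_add le_rfl ?_
    calc _ ≤ ∑ s ∈ Finset.Ico N A, (M m s : ℝ) * ((m s - 1 : ℕ) : ℝ) *
            (ε / 2 * (M m A : ℝ)⁻¹) := by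
          refine Finset.sum_le_sum fun s hs => ?_
          rw [mul_assoc]
          refine mul_le_mul_of_nonneg_left ?_ (Nat.cast_nonneg _)
          refine (Finset.sum_le_sum (hsmall s (Finset.mem_Ico.1 hs).1)).trans (le_of_eq ?_)
          rw [Finset.sum_const, Nat.card_Icc, nsmul_eq_mul, Nat.add_sub_cancel]
      _ ≤ _ := Finset.sum_le_sum_of_subset_of_nonneg
          (Finset.Ico_subset_Ico_left (Nat.zero_le N)) fun _ _ _ => by positivity
  rw [← Finset.sum_mul, sum_M_mul_eq hm] at hsum
  have : ((M m A : ℝ) - 1) * (ε / 2 * (M m A : ℝ)⁻¹) ≤ ε / 2 := by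
    rw [← mul_assoc, mul_inv_le_iff₀ hMpos]
    nlinarith
  linarith

end Convolution

section Convergence

/-! ### Boundedness in `L_p` -/

/-- Schur's test: a kernel whose marginal integrals are at most `C` acts on `L_p` with norm at
most `C`. -/
theorem eLpNorm_le_of_kernel {X : Type*} [MeasurableSpace X] {μ : Measure X} [SFinite μ]
    {H : X → X → ENNReal} (hH : Measurable (Function.uncurry H)) {C : ENNReal}
    (h1 : ∀ x, ∫⁻ t, H x t ∂μ ≤ C) (h2 : ∀ t, ∫⁻ x, H x t ∂μ ≤ C) {p : ENNReal} (hp : 1 ≤ p)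
    (hp' : p ≠ ⊤) {f F : X → ℂ} (hf : AEStronglyMeasurable f μ)
    (hF : ∀ x, ‖F x‖ₑ ≤ ∫⁻ t, ‖f t‖ₑ * H x t ∂μ) : eLpNorm F p μ ≤ C * eLpNorm f p μ := by
  have hp0 : p ≠ 0 := (zero_lt_one.trans_le hp).ne'
  set r := p.toReal with hr
  have hr1 : 1 ≤ r := by
    rw [hr, ← ENNReal.toReal_one]
    exact ENNReal.toReal_mono hp' hp
  have hr0 : 0 < r := zero_lt_one.trans_le hr1
  have hHx : ∀ x, Measurable (H x) := fun x => hH.of_uncurry_left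
  -- Jensen's inequality for the measure with density `H x`.
  have key : ∀ x, ‖F x‖ₑ ^ r ≤ C ^ (r - 1) * ∫⁻ t, ‖f t‖ₑ ^ r * H x t ∂μ := fun x => by
    have hdens : ∀ g : X → ENNReal, AEMeasurable g μ →
        ∫⁻ t, g t * H x t ∂μ = ∫⁻ t, g t ∂(μ.withDensity (H x)) := fun g hg => by
      rw [lintegral_withDensity_eq_lintegral_mul₀ (hHx x).aemeasurable hg]
      simp [mul_comm]
    have hfν : AEStronglyMeasurable f (μ.withDensity (H x)) :=
      hf.mono_ac (withDensity_absolutelyContinuous _ _)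
    have huniv : μ.withDensity (H x) Set.univ ≤ C := by
      rw [withDensity_apply _ MeasurableSet.univ, Measure.restrict_univ]
      exact h1 x
    have hL := eLpNorm_le_eLpNorm_mul_rpow_measure_univ hp hfν
    rw [eLpNorm_one_eq_lintegral_enorm, eLpNorm_eq_lintegral_rpow_enorm_toReal hp0 hp',
      ENNReal.toReal_one, ← hr, ← hdens _ hf.enorm, ← hdens _ (hf.enorm.pow_const r)] at hL
    calc ‖F x‖ₑ ^ r ≤ ((∫⁻ t, ‖f t‖ₑ ^ r * H x t ∂μ) ^ (1 / r) * C ^ (1 / 1 - 1 / r)) ^ r := by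
          refine ENNReal.rpow_le_rpow ((hF x).trans (hL.trans ?_)) hr0.le
          gcongr
          rw [one_div_one, sub_nonneg, div_le_one hr0]
          exact hr1
      _ = _ := by
          rw [ENNReal.mul_rpow_of_nonneg _ _ hr0.le, ← ENNReal.rpow_mul, ← ENNReal.rpow_mul,
            one_div_mul_cancel hr0.ne', ENNReal.rpow_one, mul_comm]
          congr 2
          field_simp
  rw [eLpNorm_eq_lintegral_rpow_enorm_toReal hp0 hp',
    eLpNorm_eq_lintegral_rpow_enorm_toReal hp0 hp', ← hr]
  have hswap : ∫⁻ x, ∫⁻ t, ‖f t‖ₑ ^ r * H x t ∂μ ∂μ ≤ C * ∫⁻ t, ‖f t‖ₑ ^ r ∂μ := by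
    rw [lintegral_lintegral_swap]
    · calc _ = ∫⁻ t, ‖f t‖ₑ ^ r * ∫⁻ x, H x t ∂μ ∂μ := by
            congr 1 with t
            rw [lintegral_const_mul _ hH.of_uncurry_right]
        _ ≤ ∫⁻ t, ‖f t‖ₑ ^ r * C ∂μ := by
            gcongr with t
            exact h2 t
        _ = _ := by
            rw [lintegral_mul_const'' _ (hf.enorm.pow_const r), mul_comm]
    · exact ((hf.comp_snd (μ := μ)).enorm.pow_const r).mul hH.aemeasurable
  calc (∫⁻ x, ‖F x‖ₑ ^ r ∂μ) ^ (1 / r)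
      ≤ (C ^ (r - 1) * (C * ∫⁻ t, ‖f t‖ₑ ^ r ∂μ)) ^ (1 / r) := by
        gcongr
        refine (lintegral_mono key).trans ?_
        rw [lintegral_const_mul'']
        · gcongr
        · refine AEMeasurable.lintegral_prod_right' (f := fun z : X × X =>
            ‖f z.2‖ₑ ^ r * H z.1 z.2) ?_
          exact ((hf.comp_snd (μ := μ)).enorm.pow_const r).mul hH.aemeasurable
    _ = C * (∫⁻ t, ‖f t‖ₑ ^ r ∂μ) ^ (1 / r) := by
        have hC : C ^ (r - 1) * C = C ^ r := by
          conv_lhs => rw [← ENNReal.rpow_one C, ← ENNReal.rpow_mul, one_mul]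
          rw [← ENNReal.rpow_add_of_nonneg _ _ (by linarith) zero_le_one, sub_add_cancel]
        rw [← mul_assoc, hC, ENNReal.mul_rpow_of_nonneg _ _ (by positivity), ← ENNReal.rpow_mul,
          mul_one_div_cancel hr0.ne', ENNReal.rpow_one]

variable {m : ℕ → ℕ} [∀ k, NeZero (m k)]

/-- Uniform boundedness of the Nörlund means on `L_p`: the factor does not depend on `n`. -/
theorem eLpNorm_norlundMean_le (hm : ∀ k, 2 ≤ m k) {q : ℕ → ℝ}
    {c : ℕ → ℕ → ℝ} {C : ℝ} {n : ℕ} (hc0 : ∀ j, 0 ≤ c n j)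
    (hcC : ∑ j ∈ Finset.range (n + 1), c n j ≤ C)
    (hc : ∀ y : G m, ‖norlundKernel m q n y‖
      ≤ ∑ j ∈ Finset.range (n + 1), c n j * majorant m j y) {p : ENNReal} (hp : 1 ≤ p)
    (hp' : p ≠ ⊤) {f : G m → ℂ} (hf : MemLp f p (haar m)) :
    eLpNorm (norlundMean m q n f) p (haar m)
      ≤ ENNReal.ofReal (C * 2) * eLpNorm f p (haar m) := by
  have hsub : Measurable fun z : G m × G m => z.1 - z.2 := by
    refine measurable_pi_lambda _ fun k => ?_
    have hk : Measurable fun z : G m × G m => (z.1 k, z.2 k) := by fun_prop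
    exact (measurable_of_countable fun z : ZMod (m k) × ZMod (m k) => z.1 - z.2).comp hk
  have hmeas : Measurable fun y : G m => ∑ j ∈ Finset.range (n + 1), c n j * majorant m j y :=
    Finset.measurable_sum _ fun j _ => (measurable_majorant j).const_mul _
  have hnn : ∀ y : G m, 0 ≤ ∑ j ∈ Finset.range (n + 1), c n j * majorant m j y := fun y =>
    Finset.sum_nonneg fun j _ => mul_nonneg (hc0 j) (majorant_nonneg j y)
  have hmarg : ∀ u : G m → G m, Measurable u → (∀ j, ∫ t, majorant m j (u t) ∂(haar m) ≤ 2) →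
      ∫⁻ t, ENNReal.ofReal (∑ j ∈ Finset.range (n + 1), c n j * majorant m j (u t)) ∂(haar m)
        ≤ ENNReal.ofReal (C * 2) := fun u hu hle => by
    have hi : ∀ j, Integrable (fun t => majorant m j (u t)) (haar m) := fun j => by
      obtain ⟨K, hK⟩ := majorant_le (m := m) j
      refine Integrable.of_bound ((measurable_majorant j).comp hu).aestronglyMeasurable K
        (ae_of_all _ fun t => ?_)
      rw [Real.norm_of_nonneg (majorant_nonneg _ _)]
      exact hK _
    rw [← ofReal_integral_eq_lintegral_ofReal
      (integrable_finsetSum _ fun j _ => (hi j).const_mul _) (ae_of_all _ fun t => hnn _),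
      integral_finsetSum _ fun j _ => (hi j).const_mul _]
    simp_rw [integral_const_mul]
    refine ENNReal.ofReal_le_ofReal ?_
    calc _ ≤ ∑ j ∈ Finset.range (n + 1), c n j * 2 :=
          Finset.sum_le_sum fun j _ => mul_le_mul_of_nonneg_left (hle j) (hc0 j)
      _ ≤ C * 2 := by
          rw [← Finset.sum_mul]
          gcongr
  refine eLpNorm_le_of_kernel (H := fun x t =>
    ENNReal.ofReal (∑ j ∈ Finset.range (n + 1), c n j * majorant m j (x - t)))
    (hmeas.comp hsub).ennreal_ofReal
    (fun x => hmarg _ (by fun_prop) fun j => integral_majorant_sub_left_le hm j x)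
    (fun t => hmarg _ (by fun_prop) fun j => integral_majorant_sub_right_le hm j t)
    hp hp' hf.aestronglyMeasurable fun x => ?_
  rw [norlundMean_eq_integral (hf.integrable hp)]
  refine (enorm_integral_le_lintegral_enorm _).trans (lintegral_mono fun t => ?_)
  rw [enorm_mul]
  gcongr
  rw [← ofReal_norm]
  exact ENNReal.ofReal_le_ofReal (hc _)

/-! ### Convergence of Nörlund means -/

theorem tendsto_norlundMean_of_isVilenkinLebesguePoint (hm : ∀ k, 2 ≤ m k) {q : ℕ → ℝ}
    (hq : ∀ k, 0 ≤ q k) (hq0 : 0 < q 0) {c : ℕ → ℕ → ℝ} {C : ℝ} (hc0 : ∀ n j, 0 ≤ c n j)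
    (hcC : ∀ᶠ n in atTop, ∑ j ∈ Finset.range (n + 1), c n j ≤ C)
    (hcj : ∀ j, Tendsto (fun n => c n j) atTop (𝓝 0))
    (hc : ∀ n (y : G m), ‖norlundKernel m q n y‖
      ≤ ∑ j ∈ Finset.range (n + 1), c n j * majorant m j y) {f : G m → ℂ} {x : G m}
    (hx : IsVilenkinLebesguePoint m f x) :
    Tendsto (fun n => norlundMean m q n f x) atTop (𝓝 (f x)) := by
  obtain ⟨hf, hW⟩ := hx
  have hfx : Integrable (fun t => f t - f x) (haar m) := hf.sub (integrable_const _)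
  have hconv : Tendsto (fun j => convMajorant m j (fun t => ‖f t - f x‖) x) atTop (𝓝 0) := by
    have h := (tendsto_mean_of_tendsto_W hm hfx.norm (fun _ => norm_nonneg _) x hW).add hW
    rw [add_zero] at h
    refine h.congr fun j => ?_
    rw [convMajorant_eq hfx.norm, W]
  have hT := tendsto_toeplitz hc0 hcC hcj
    (fun j => integral_nonneg fun t => mul_nonneg (norm_nonneg _) (majorant_nonneg _ _)) hconv
  rw [tendsto_iff_norm_sub_tendsto_zero]
  refine squeeze_zero' (Eventually.of_forall fun n => norm_nonneg _) ?_ hT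
  filter_upwards [eventually_ne_atTop 0] with n hn
  have h := norm_norlundMean_le hfx (hc n) x
  rwa [norlundMean_sub hf (integrable_const _), norlundMean_const hm hq hq0 hn] at h

theorem tendsto_eLpNorm_norlundMean_sub_of_continuous (hm : ∀ k, 2 ≤ m k) {q : ℕ → ℝ}
    (hq : ∀ k, 0 ≤ q k) (hq0 : 0 < q 0) {c : ℕ → ℕ → ℝ} {C : ℝ} (hc0 : ∀ n j, 0 ≤ c n j)
    (hcC : ∀ᶠ n in atTop, ∑ j ∈ Finset.range (n + 1), c n j ≤ C)
    (hcj : ∀ j, Tendsto (fun n => c n j) atTop (𝓝 0))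
    (hc : ∀ n (y : G m), ‖norlundKernel m q n y‖
      ≤ ∑ j ∈ Finset.range (n + 1), c n j * majorant m j y) {p : ENNReal} (hp : 1 ≤ p)
    (hp' : p ≠ ⊤) (g : BoundedContinuousFunction (G m) ℂ) :
    Tendsto (fun n => eLpNorm (fun x => norlundMean m q n g x - g x) p (haar m)) atTop (𝓝 0) := by
  have hp0 : p ≠ 0 := (zero_lt_one.trans_le hp).ne'
  have hr0 : 0 < p.toReal := ENNReal.toReal_pos hp0 hp'
  have hgi : Integrable g (haar m) := g.integrable _
  have hbound : ∀ᶠ n in atTop, ∀ x,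
      ‖norlundMean m q n g x - g x‖ₑ ≤ ENNReal.ofReal (C * (‖g‖ * 2) + ‖g‖) := by
    filter_upwards [hcC] with n hn x
    have hj : ∀ j, convMajorant m j (fun t => ‖g t‖) x ≤ ‖g‖ * 2 := fun j => by
      calc _ ≤ ∫ t, ‖g‖ * majorant m j (x - t) ∂(haar m) := by
            refine integral_mono (integrable_mul_majorant hgi.norm j x)
              (integrable_mul_majorant (integrable_const ‖g‖) j x) fun t => ?_
            exact mul_le_mul_of_nonneg_right (g.norm_coe_le_norm t) (majorant_nonneg _ _)
        _ ≤ ‖g‖ * 2 := by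
            rw [integral_const_mul]
            exact mul_le_mul_of_nonneg_left (integral_majorant_sub_left_le hm j x) (norm_nonneg _)
    have h1 : ‖norlundMean m q n g x‖ ≤ C * (‖g‖ * 2) := by
      refine (norm_norlundMean_le hgi (hc n) x).trans ?_
      calc _ ≤ ∑ j ∈ Finset.range (n + 1), c n j * (‖g‖ * 2) :=
            Finset.sum_le_sum fun j _ => mul_le_mul_of_nonneg_left (hj j) (hc0 n j)
        _ ≤ _ := by
            rw [← Finset.sum_mul]
            gcongr
    rw [← ofReal_norm]
    exact ENNReal.ofReal_le_ofReal
      ((norm_sub_le _ _).trans (add_le_add h1 (g.norm_coe_le_norm x)))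
  have hlim := tendsto_lintegral_filter_of_dominated_convergence (μ := haar m) (l := atTop)
    (F := fun n x => ‖norlundMean m q n g x - g x‖ₑ ^ p.toReal) (f := fun _ => 0)
    (fun _ => ENNReal.ofReal (C * (‖g‖ * 2) + ‖g‖) ^ p.toReal)
    (Eventually.of_forall fun n =>
      ((measurable_norlundMean q n g).sub g.continuous.measurable).enorm.pow_const _)
    (by
      filter_upwards [hbound] with n hn
      exact ae_of_all _ fun x => ENNReal.rpow_le_rpow (hn x) hr0.le)
    (by
      rw [lintegral_const, measure_univ, mul_one]
      exact ENNReal.rpow_ne_top_of_nonneg hr0.le ENNReal.ofReal_ne_top)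
    (ae_of_all _ fun x => by
      have h := tendsto_norlundMean_of_isVilenkinLebesguePoint hm hq hq0 hc0 hcC hcj hc
        (isVilenkinLebesguePoint_of_continuousAt hm hgi (x := x) g.continuous.continuousAt)
      have h2 := (ENNReal.continuous_rpow_const (y := p.toReal)).tendsto 0 |>.comp
        ((tendsto_iff_enorm_sub_tendsto_zero).1 h)
      simpa [Function.comp_def, ENNReal.zero_rpow_of_pos hr0] using h2)
  have h := (ENNReal.continuous_rpow_const (y := 1 / p.toReal)).tendsto _ |>.comp hlim
  simp only [lintegral_zero, ENNReal.zero_rpow_of_pos (one_div_pos.2 hr0)] at h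
  refine h.congr fun n => ?_
  rw [eLpNorm_eq_lintegral_rpow_enorm_toReal hp0 hp']
  rfl

end Convergence

end Vilenkin

end

theorem theorem1 (m : ℕ → ℕ) [∀ k, NeZero (m k)] (hm : ∀ k, 2 ≤ m k)
    (hbdd : BddAbove (Set.range m))
    (q : ℕ → ℝ) (hq : ∀ k, 0 ≤ q k) (hq0 : 0 < q 0)
    (hmono : (Monotone q ∧ IsNorlundRegular q) ∨
      (Antitone q ∧ (fun n : ℕ => 1 / Q q n) =O[atTop] (fun n : ℕ => 1 / (n : ℝ)))) :
    (∀ p : ENNReal, 1 ≤ p → p ≠ ⊤ → ∀ f : G m → ℂ, MemLp f p (haar m) →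
      Tendsto (fun n => eLpNorm (fun x => norlundMean m q n f x - f x) p (haar m))
        atTop (𝓝 0)) ∧
    (∀ f : G m → ℂ, Integrable f (haar m) → ∀ x : G m, ContinuousAt f x →
      Tendsto (fun n => norlundMean m q n f x) atTop (𝓝 (f x))) ∧
    (∀ p : ENNReal, 1 ≤ p → p ≠ ⊤ → ∀ f : G m → ℂ, MemLp f p (haar m) →
      ∀ x : G m, IsVilenkinLebesguePoint m f x →
        Tendsto (fun n => norlundMean m q n f x) atTop (𝓝 (f x))) := by
  obtain ⟨c, C, hc0, hcC, hcj, hc⟩ := exists_norlundKernel_bound hm hbdd hq hq0 hmono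
  have hVL : ∀ f : G m → ℂ, ∀ x : G m, IsVilenkinLebesguePoint m f x →
      Tendsto (fun n => norlundMean m q n f x) atTop (𝓝 (f x)) := fun f x hx =>
    tendsto_norlundMean_of_isVilenkinLebesguePoint hm hq hq0 hc0 hcC hcj hc hx
  refine ⟨fun p hp hp' f hf => ?_, fun f hf x hx =>
    hVL f x (isVilenkinLebesguePoint_of_continuousAt hm hf hx), fun p _ _ f _ x hx => hVL f x hx⟩
  refine ENNReal.tendsto_nhds_zero.2 fun ε hε => ?_
  set K : ENNReal := ENNReal.ofReal (C * 2) with hK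
  have hK1 : K + 1 ≠ ⊤ := by simp [hK]
  have hδ : ε / 2 / (K + 1) ≠ 0 := ENNReal.div_ne_zero.2 ⟨(ENNReal.half_pos hε.ne').ne', hK1⟩
  obtain ⟨g, hg, hgp⟩ := hf.exists_boundedContinuous_eLpNorm_sub_le hp' hδ
  have hg0 := tendsto_eLpNorm_norlundMean_sub_of_continuous hm hq hq0 hc0 hcC hcj hc hp hp' g
  filter_upwards [hcC, ENNReal.tendsto_nhds_zero.1 hg0 (ε / 2) (ENNReal.half_pos hε.ne')]
    with n hn hgn
  have hfm := hf.aestronglyMeasurable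
  have hgm := hgp.aestronglyMeasurable
  have e : (fun x => norlundMean m q n f x - f x)
      = (norlundMean m q n (fun t => f t - g t) - (f - ⇑g))
        + fun x => norlundMean m q n g x - g x := by
    funext x
    simp only [Pi.add_apply, Pi.sub_apply, norlundMean_sub (hf.integrable hp) (hgp.integrable hp)]
    ring
  have hd := measurable_norlundMean q n (fun t => f t - g t)
  have h1 : eLpNorm (norlundMean m q n (fun t => f t - g t)) p (haar m)
      ≤ K * eLpNorm (f - ⇑g) p (haar m) :=
    eLpNorm_norlundMean_le hm (hc0 n) hn (hc n) hp hp' (hf.sub hgp)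
  calc eLpNorm (fun x => norlundMean m q n f x - f x) p (haar m)
      ≤ eLpNorm (norlundMean m q n (fun t => f t - g t)) p (haar m) + eLpNorm (f - ⇑g) p (haar m)
        + eLpNorm (fun x => norlundMean m q n g x - g x) p (haar m) := by
        rw [e]
        refine (eLpNorm_add_le (hd.aestronglyMeasurable.sub (hfm.sub hgm))
          ((measurable_norlundMean q n g).aestronglyMeasurable.sub hgm) hp).trans ?_
        exact add_le_add (eLpNorm_sub_le hd.aestronglyMeasurable (hfm.sub hgm) hp) le_rfl
    _ ≤ (K + 1) * (ε / 2 / (K + 1)) + ε / 2 := by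
        rw [add_mul, one_mul]
        gcongr
        exact h1.trans (by gcongr)
    _ = ε := by
        rw [ENNReal.mul_div_cancel (by simp) hK1, ENNReal.add_halves]
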